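/- \textbf{Setting.} Let $n,L,M\ge 1$ and $1\le K_a\le K$ be integers (for instance $M=2^J$) and $P>0$. There are $K$ single-antenna users; the users in a fixed set $\mathcal K_a$ with $|\mathcal K_a|=K_a$ are active, and the receiver has $L$ antennas. For $0<P'<P$ let $\mathbf c_{k,m}\in\mathbb C^n$, $k\in[K]$, $m\in[M]$, be codewords with i.i.d. $\mathcal{CN}(0,P')$ entries, known to the receiver. The codewords that are used are $\mathbf x_{k,m}=\mathbf c_{k,m}1\{\|\mathbf c_{k,m}\|_2^2\le nP\}$, so that the maximum power constraint $\|\mathbf x_{k,m}\|_2^2\le nP$ holds. Each active user $k$ sends $\mathbf x_{k,W_k}$ with $W_k$ uniform on $[M]$, and antenna $l$ receives $$\mathbf y_l=\sum_{k\in\mathcal K_a}h_{k,l}\,\mathbf x_{k,W_k}+\mathbf z_l,\qquad l=1,\dots,L,$$ with i.i.d. $h_{k,l}\sim\mathcal{CN}(0,1)$ and i.i.d. $\mathbf z_l\sim\mathcal{CN}(\mathbf 0,\mathbf I_n)$; codebooks, messages, fading and noise are independent. Put $\mathbf Y=[\mathbf y_1,\dots,\mathbf y_L]$. The receiver knows $K_a$,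 but neither $\mathcal K_a$ nor the fading coefficients. Its maximum likelihood decoder returns a set $\hat{\mathcal K}_a\subset[K]$ of size $K_a$ and messages $(\hat W_k)_{k\in\hat{\mathcal K}_a}$ that minimise $$L\ln|\mathbf G|+\operatorname{tr}\left(\mathbf G^{-1}\mathbf Y\mathbf Y^H\right),\qquad \mathbf G=\mathbf I_n+\sum_{k\in\hat{\mathcal K}_a}\mathbf c_{k,\hat W_k}\mathbf c_{k,\hat W_k}^H,$$ with any measurable rule for ties, and $\hat W_k=0$ for $k\notin\hat{\mathcal K}_a$. Let $P_e(P')=\frac1{K_a}\sum_{k\in\mathcal K_a}\mathbb P[W_k\ne\hat W_k]$ be its per-user probability of error (PUPE), the probability being taken over codebooks, messages, fading and noise. \textbf{Theorem.} For every such decoder and every $P'\in(0,P)$, $$P_e(P')\le p_0+\sum_{t=1}^{K_a}\frac t{K_a}\min\{1,p_t\},$$ and consequently $\inf_{0<P'<P}P_e(P')\le\inf_{0<P'<P}\left\{p_0+\sum_{t=1}^{K_a}\frac t{K_a}\min\{1,p_t\}\right\}$. Here $\gamma(a,x)=\int_0^xs^{a-1}e^{-s}\,ds$ for $x>0$ and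 $\gamma(a,x)=0$ for $x\le0$, each $\min$ over parameters below is an infimum, and $$p_0=K_a\left(1-\frac{\gamma(n,nP/P')}{\Gamma(n)}\right),\qquad p_t=\min_{0\le\omega\le1,\ \nu\ge0}\left\{q_{1,t}(\omega,\nu)+q_{2,t}(\omega,\nu)\right\},$$ $$q_{1,t}(\omega,\nu)=\binom{K_a}t\binom{K-K_a+t}tM^t\;\mathbb E\left[\min_{u\ge0,\ r\ge0,\ \lambda_{\min}(\mathbf B)>0}e^{Lrn\nu}\,e^{L\left((u-r)\ln|\mathbf F|-u\ln|\mathbf F'|+r\omega\ln|\mathbf F_1|-\ln|\mathbf B|\right)}\right],$$ $$\mathbf B=(1-u+r)\mathbf I_n+u(\mathbf F')^{-1}\mathbf F-r\omega\,\mathbf F_1^{-1}\mathbf F,\qquad \mathbf F=\mathbf I_n+\mathbf A\mathbf A^H,$$ $$\mathbf F_1=\mathbf I_n+\mathbf A_{[K_a]\setminus S_1}\mathbf A_{[K_a]\setminus S_1}^H,\qquad \mathbf F'=\mathbf F_1+\mathbf A'(\mathbf A')^H,$$ $$q_{2,t}(\omega,\nu)=\min_{\delta\ge0}\left\{\binom{K_a}t\mathbb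 E\left[\frac{\gamma\left(Lm,\ L\prod_{i=1}^m\lambda_i^{-1/m}\,\frac{N}{\omega}\right)}{\Gamma(Lm)}\right]+\binom{K_a}t\left(1-\frac{\gamma(nL,nL(1+\delta))}{\Gamma(nL)}\right)\right\},$$ $$N=n(1+\delta)(1-\omega)-\omega\ln|\mathbf F_1|+\ln|\mathbf F|-n\nu .$$ The matrices $\mathbf A\in\mathbb C^{n\times K_a}$ and $\mathbf A'\in\mathbb C^{n\times t}$ are independent with i.i.d. $\mathcal{CN}(0,P')$ entries, $S_1$ is an arbitrary $t$-subset of $[K_a]$, $\mathbf A_S$ consists of the columns of $\mathbf A$ with index in $S$, $m=\min\{n,t\}$, and $\lambda_1,\dots,\lambda_m$ are the (almost surely exactly $m$) non-zero eigenvalues of $\mathbf F_1^{-1}\mathbf A_{S_1}\mathbf A_{S_1}^H$. For $\omega=0$ the ratio inside the expectation in $q_{2,t}$ is read as $1$ if $N>0$ and as $0$ if $N\le0$. -/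

import Mathlib

open MeasureTheory ProbabilityTheory Matrix
open scoped BigOperators NNReal

noncomputable section

namespace MassiveAccess

/-! ### Probability laws -/

/-- The circularly symmetric complex Gaussian law `CN(0, v)`: real and imaginary parts are
independent `N(0, v / 2)`. -/
def complexGaussian (v : ℝ) : Measure ℂ :=
  ((gaussianReal 0 (v / 2).toNNReal).prod (gaussianReal 0 (v / 2).toNNReal)).map
    (fun p : ℝ × ℝ => (⟨p.1, p.2⟩ : ℂ))

/-- The law on `ι → κ → ℂ` with i.i.d. `CN(0, v)` entries. -/
def iidGaussian (ι κ : Type) [Fintype ι] [Fintype κ] (v : ℝ) : Measure (ι → κ → ℂ) :=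
  Measure.pi fun _ => Measure.pi fun _ => complexGaussian v

/-! ### The channel -/

/-- Codebooks of all `K` users: `c k m` is the `m`-th codeword, in `ℂⁿ`, of user `k`. -/
abbrev Codebook (n K M : ℕ) : Type := Fin K → Fin M → Fin n → ℂ

/-- Received signals: `y i l` is the `i`-th symbol at the `l`-th antenna. -/
abbrev Received (n L : ℕ) : Type := Fin n → Fin L → ℂ

/-- What is sent, or decoded, for each user: a message, or `none` for an inactive user
(`none` plays the role of the message `0`). -/
abbrev Messages (K M : ℕ) : Type := Fin K → Option (Fin M)

/-- The set of users that carry a message. -/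
def support {K M : ℕ} (d : Messages K M) : Finset (Fin K) :=
  Finset.univ.filter fun k => d k ≠ none

/-- The messages that are sent when the active users are those in `act`. -/
def sent {K M : ℕ} (act : Finset (Fin K)) (w : Fin K → Fin M) : Messages K M :=
  fun k => if k ∈ act then some (w k) else none

/-- The codeword that the codebook `c` assigns to user `k` under `d`; it is `0` for an inactive
user. -/
def codeword {n K M : ℕ} (c : Codebook n K M) (d : Messages K M) (k : Fin K) : Fin n → ℂ :=
  match d k with
  | some m => c k m
  | none => 0

/-- The power-constrained codebook: codewords with `‖c‖² > n P` are replaced by `0`. -/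
def constrained {n K M : ℕ} (P : ℝ) (c : Codebook n K M) : Codebook n K M :=
  open Classical in
  fun k m => if ∑ i, ‖c k m i‖ ^ 2 ≤ n * P then c k m else 0

/-- The received signal `Y`, with `y i l = ∑ k, h k l * x k i + z i l`, when the codebook `x` is
used to send `d` over the fading coefficients `h` with additive noise `z`. -/
def channelOutput {n K M L : ℕ} (x : Codebook n K M) (d : Messages K M)
    (h : Fin K → Fin L → ℂ) (z : Fin n → Fin L → ℂ) : Received n L :=
  fun i l => ∑ k, h k l * codeword x d k i + z i l

/-! ### The decoder -/

/-- The covariance matrix `I + ∑ k, c k (c k)ᴴ` for the codewords selected by `d`. -/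
def decisionCov {n K M : ℕ} (c : Codebook n K M) (d : Messages K M) :
    Matrix (Fin n) (Fin n) ℂ :=
  1 + ∑ k ∈ support d, vecMulVec (codeword c d k) (star (codeword c d k))

/-- The maximum likelihood metric `L ln |G| + tr (G⁻¹ Y Yᴴ)`, where `G = I + ∑ k, c k (c k)ᴴ`. -/
def mlMetric {n K M L : ℕ} (c : Codebook n K M) (y : Received n L) (d : Messages K M) : ℝ :=
  L * Real.log (decisionCov c d).det.re +
    ((decisionCov c d)⁻¹ * ((Matrix.of y) * (Matrix.of y)ᴴ)).trace.re

/-- `dec` is a maximum likelihood decoder that knows the codebooks and the number `Ka` of active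
users: it returns a minimiser of the metric among all choices of `Ka` users with one message for
each of them (ties are broken in any measurable way). -/
structure IsMLDecoder {n K M L : ℕ} (Ka : ℕ)
    (dec : Codebook n K M → Received n L → Messages K M) : Prop where
  card_support : ∀ c y, (support (dec c y)).card = Ka
  metric_le : ∀ c y d, (support d).card = Ka → mlMetric c y (dec c y) ≤ mlMetric c y d
  measurableSet_eq : ∀ d, MeasurableSet {p : Codebook n K M × Received n L | dec p.1 p.2 = d}

/-! ### The per-user probability of error -/

/-- The random experiment: Gaussian codebooks, messages, fading coefficients and noise. -/
abbrev Sample (n K M L : ℕ) : Type :=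
  Codebook n K M × (Fin K → Fin M) × (Fin K → Fin L → ℂ) × (Fin n → Fin L → ℂ)

/-- Independent codebooks with i.i.d. `CN(0, P')` entries, uniform messages, i.i.d. `CN(0, 1)`
fading coefficients and i.i.d. `CN(0, 1)` noise. -/
def sampleLaw (n K M L : ℕ) (P' : ℝ) : Measure (Sample n K M L) :=
  (Measure.pi fun _ : Fin K => iidGaussian (Fin M) (Fin n) P').prod
    ((Measure.pi fun _ : Fin K => uniformOn (Set.univ : Set (Fin M))).prod
      ((iidGaussian (Fin K) (Fin L) 1).prod (iidGaussian (Fin n) (Fin L) 1)))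

/-- The received signal of the random experiment: the active users send their codewords from the
power-constrained codebooks. -/
def receivedSignal {n K M L : ℕ} (P : ℝ) (act : Finset (Fin K)) (s : Sample n K M L) :
    Received n L :=
  channelOutput (constrained P s.1) (sent act s.2.1) s.2.2.1 s.2.2.2

/-- The per-user probability of error `(1 / |act|) ∑ k ∈ act, ℙ[W k ≠ Ŵ k]` of Gaussian random
coding with variance `P'` and power constraint `P`, when the active users are those in `act`. -/
def pupe {n K M L : ℕ} (P P' : ℝ) (act : Finset (Fin K))
    (dec : Codebook n K M → Received n L → Messages K M) : ℝ :=
  (1 / (act.card : ℝ)) * ∑ k ∈ act,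
    (sampleLaw n K M L P').real {s | dec s.1 (receivedSignal P act s) k ≠ some (s.2.1 k)}

/-! ### The bound -/

/-- The normalised lower incomplete gamma function `γ(a, x) / Γ(a)`; it is `0` for `x ≤ 0`. -/
def regGamma (a x : ℝ) : ℝ :=
  (∫ s in Set.Ioc 0 x, s ^ (a - 1) * Real.exp (-s)) / Real.Gamma a

/-- `A_S A_Sᴴ`, where `A_S` consists of the columns `a k` of `A` with `k ∈ S`. -/
def gram {n : ℕ} {ι : Type} (a : ι → Fin n → ℂ) (S : Finset ι) : Matrix (Fin n) (Fin n) ℂ :=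
  ∑ k ∈ S, vecMulVec (a k) (star (a k))

/-- `F = I + A_{𝒦ₐ} A_{𝒦ₐ}ᴴ`; the columns of `A_{𝒦ₐ}` are `a k`. -/
def matF {n Ka : ℕ} (a : Fin Ka → Fin n → ℂ) : Matrix (Fin n) (Fin n) ℂ :=
  1 + gram a Finset.univ

/-- `F₁ = I + A_{𝒦ₐ∖S₁} A_{𝒦ₐ∖S₁}ᴴ`. -/
def matF1 {n Ka : ℕ} (S₁ : Finset (Fin Ka)) (a : Fin Ka → Fin n → ℂ) :
    Matrix (Fin n) (Fin n) ℂ :=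
  1 + gram a (Finset.univ \ S₁)

/-- `F' = I + A_{𝒦ₐ∖S₁} A_{𝒦ₐ∖S₁}ᴴ + A'_{S₂} A'_{S₂}ᴴ`; the columns of `A'_{S₂}` are `a' j`. -/
def matF' {n Ka t : ℕ} (S₁ : Finset (Fin Ka)) (a : Fin Ka → Fin n → ℂ) (a' : Fin t → Fin n → ℂ) :
    Matrix (Fin n) (Fin n) ℂ :=
  1 + gram a (Finset.univ \ S₁) + gram a' Finset.univ

/-- `B = (1 - u + r) I + u F'⁻¹ F - r ω F₁⁻¹ F`. -/
def matB {n Ka t : ℕ} (S₁ : Finset (Fin Ka)) (ω u r : ℝ) (a : Fin Ka → Fin n → ℂ)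
    (a' : Fin t → Fin n → ℂ) : Matrix (Fin n) (Fin n) ℂ :=
  ((1 - u + r : ℝ) : ℂ) • (1 : Matrix (Fin n) (Fin n) ℂ)
    + (u : ℂ) • ((matF' S₁ a a')⁻¹ * matF a) - ((r * ω : ℝ) : ℂ) • ((matF1 S₁ a)⁻¹ * matF a)

/-- `ln |X|` for a matrix with positive determinant. -/
def logDet {n : ℕ} (X : Matrix (Fin n) (Fin n) ℂ) : ℝ := Real.log X.det.re

/-- The parameters `(u, r)` with `u ≥ 0`, `r ≥ 0` and `λ_min(B) > 0`. The matrix `B` is a product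
of a Hermitian and a positive definite matrix, so that its eigenvalues are real. -/
def admissible {n Ka t : ℕ} (S₁ : Finset (Fin Ka)) (ω : ℝ) (a : Fin Ka → Fin n → ℂ)
    (a' : Fin t → Fin n → ℂ) : Set (ℝ × ℝ) :=
  {p | 0 ≤ p.1 ∧ 0 ≤ p.2 ∧ ∀ z ∈ spectrum ℂ (matB S₁ ω p.1 p.2 a a'), 0 < z.re}

/-- The minimum over `(u, r)` inside the expectation in `q_{1,t}`. -/
def q1Integrand {n Ka t : ℕ} (L : ℕ) (S₁ : Finset (Fin Ka)) (ω ν : ℝ) (a : Fin Ka → Fin n → ℂ)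
    (a' : Fin t → Fin n → ℂ) : ℝ :=
  ⨅ p : admissible S₁ ω a a',
    Real.exp (L * p.1.2 * n * ν) *
      Real.exp (L * ((p.1.1 - p.1.2) * logDet (matF a) - p.1.1 * logDet (matF' S₁ a a')
        + p.1.2 * ω * logDet (matF1 S₁ a) - logDet (matB S₁ ω p.1.1 p.1.2 a a')))

/-- `q_{1,t}(ω, ν)`. Transmitted and false-alarm codewords are distinct codewords of the
codebooks, hence all their entries are i.i.d. `CN(0, P')`. -/
def q1 (n K Ka M L t : ℕ) (P' : ℝ) (S₁ : Finset (Fin Ka)) (ω ν : ℝ) : ℝ :=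
  (Ka.choose t : ℝ) * ((K - Ka + t).choose t : ℝ) * (M : ℝ) ^ t *
    ∫ p : (Fin Ka → Fin n → ℂ) × (Fin t → Fin n → ℂ), q1Integrand L S₁ ω ν p.1 p.2
      ∂((iidGaussian (Fin Ka) (Fin n) P').prod (iidGaussian (Fin t) (Fin n) P'))

/-- `∏ i, λ i ^ (-1 / m)` over the non-zero eigenvalues `λ i` (with multiplicity) of
`F₁⁻¹ A_{S₁} A_{S₁}ᴴ`. -/
def eigenFactor {n Ka : ℕ} (m : ℕ) (S₁ : Finset (Fin Ka)) (a : Fin Ka → Fin n → ℂ) : ℝ :=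
  open Classical in
  ((((matF1 S₁ a)⁻¹ * gram a S₁).charpoly.roots.filter fun z => z ≠ 0).map
    fun z => z.re ^ (-(1 / (m : ℝ)))).prod

/-- The numerator `n (1 + δ) (1 - ω) - ω ln |F₁| + ln |F| - n ν`. -/
def q2Numerator {n Ka : ℕ} (S₁ : Finset (Fin Ka)) (ω ν δ : ℝ) (a : Fin Ka → Fin n → ℂ) : ℝ :=
  n * (1 + δ) * (1 - ω) - ω * logDet (matF1 S₁ a) + logDet (matF a) - n * ν

/-- The ratio of incomplete gamma functions inside the expectation in `q_{2,t}`, `m = min n t`.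
For `ω = 0` the argument of `γ` is read as `+∞` if the numerator is positive, where the ratio
is `1`, and otherwise the ratio is `0`. -/
def q2Integrand {n Ka : ℕ} (L m : ℕ) (S₁ : Finset (Fin Ka)) (ω ν δ : ℝ)
    (a : Fin Ka → Fin n → ℂ) : ℝ :=
  open Classical in
  if ω = 0 then (if 0 < q2Numerator S₁ ω ν δ a then 1 else 0)
  else regGamma (L * m) (L * eigenFactor m S₁ a * (q2Numerator S₁ ω ν δ a / ω))

/-- `q_{2,t}(ω, ν)`. -/
def q2 (n Ka L t : ℕ) (P' : ℝ) (S₁ : Finset (Fin Ka)) (ω ν : ℝ) : ℝ :=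
  ⨅ δ : Set.Ici (0 : ℝ),
    ((Ka.choose t : ℝ) * (∫ a : Fin Ka → Fin n → ℂ, q2Integrand L (min n t) S₁ ω ν δ a
        ∂(iidGaussian (Fin Ka) (Fin n) P'))
      + (Ka.choose t : ℝ) * (1 - regGamma (n * L) (n * L * (1 + δ))))

/-- `p_t = min_{0 ≤ ω ≤ 1, 0 ≤ ν} (q_{1,t}(ω, ν) + q_{2,t}(ω, ν))`. -/
def pt (n K Ka M L t : ℕ) (P' : ℝ) (S₁ : Finset (Fin Ka)) : ℝ :=
  ⨅ p : Set.Icc (0 : ℝ) 1 × Set.Ici (0 : ℝ),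
    (q1 n K Ka M L t P' S₁ p.1 p.2 + q2 n Ka L t P' S₁ p.1 p.2)

/-- `p₀ = Kₐ (1 - γ(n, n P / P') / Γ(n))`. -/
def p0 (n Ka : ℕ) (P P' : ℝ) : ℝ := Ka * (1 - regGamma n (n * P / P'))

/-- `p₀ + ∑_{t=1}^{Kₐ} (t / Kₐ) min {1, p_t}`, with `S₁ t` the chosen `t`-subset. -/
def pupeBound (n K Ka M L : ℕ) (P P' : ℝ) (S₁ : ℕ → Finset (Fin Ka)) : ℝ :=
  p0 n Ka P P' + ∑ t ∈ Finset.Icc 1 Ka, ((t : ℝ) / Ka) * min 1 (pt n K Ka M L t P' (S₁ t))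

end MassiveAccess

end

/-!
The codewords that are used differ from the Gaussian ones only if some transmitted codeword has
squared norm above `n P`. The squared norm of a vector with i.i.d. `CN(0, P')` entries is gamma
distributed (`map_normSq_pi`), so by the union bound over the active users this has probability at
most `p₀` (`sampleLaw_powerViolation_le`), and outside of this event the unconstrained codebooks
may be sent. For these the error probabilities of the users add up to
`∑ t, t ℙ[t users are misdecoded]` (`sum_measureReal_misdecoded`), and it remains to bound the
probability that exactly `t` users are misdecoded by `q₁(ω, ν)` plus each of the terms whose
infimum over `δ` is `q₂(ω, ν)`.

If the set `S'` of users is misdecoded, the decoder has replaced their codewords by `t` others, with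
covariance `F'` in place of `F`, and its metric at `F'` is at most that at `F`. A union bound over
`S'` and the false alarms would lose too much when the metric at `F` is large, so Gallager's device
is used (`measure_card_misdecoded_le`). The atypical event that the metric at `F` exceeds `ω` times
that at `F₁` by more than `n L ν` does not involve the false alarms, and is therefore counted only
`Kₐ choose t` times; the union over the false alarms is restricted to the complement of this event.
All the codewords involved carry distinct labels, hence are i.i.d. Gaussian
(`map_selectWords_prod`), and the probabilities can be computed first for a fixed codebook.

Given the codebook, the received signal has the law of `R Z`, where `Z` is a standard Gaussian matrix
and `R Rᴴ = F` (`map_add_eq_map_mul`). The metrics become quadratic forms in `Z`, which are made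
diagonal by simultaneous diagonalisation of Hermitian forms
(`exists_simultaneous_diagonalization`).

* For the confusion event, Chernoff's bound with multipliers `u` and `r` of the two inequalities
  leads to the Laplace transform of a diagonal form whose weights `d` satisfy `∏ d = |B|`; it is
  finite exactly if `B` has positive eigenvalues
  (`exists_diagonalization_matB`, `measure_confusion_le_chernoffValue`).
* For the atypical event, apart from `‖Z‖² > n L (1 + δ)`, the form whose weights are the eigenvalues
  of `F₁⁻¹ A_{S₁} A_{S₁}ᴴ` has to be small. An ellipsoid has at most the Gaussian mass of the ball of
  the same volume (`iidGaussian_ellipsoid_le_ball`), so the non-zero eigenvalues may be replaced by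
  their geometric mean, and an incomplete gamma function results (`measure_atypical_le`).
-/

namespace MassiveAccess

open scoped ComplexOrder

/-! ### Simultaneous diagonalisation of Hermitian forms -/

section Diagonalisation

variable {ι : Type*} [Fintype ι] [DecidableEq ι]

/-- A positive definite form and a Hermitian form are diagonalised by one change of basis. -/
theorem exists_simultaneous_diagonalization {F G : Matrix ι ι ℂ} (hF : F.PosDef)
    (hG : G.IsHermitian) :
    ∃ (R : Matrix ι ι ℂ) (d : ι → ℝ), IsUnit R ∧ F = R * Rᴴ ∧
      G = R * diagonal (fun i => (d i : ℂ)) * Rᴴ := by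
  obtain ⟨S, hSu, hS⟩ : ∃ S : Matrix ι ι ℂ, IsUnit S ∧ F = S * Sᴴ := by
    open scoped MatrixOrder in
    obtain ⟨S, hS⟩ := CStarAlgebra.nonneg_iff_eq_mul_star_self.mp hF.posSemidef.nonneg
    refine ⟨S, ?_, hS⟩
    have hu := hF.isUnit
    rw [hS, Matrix.isUnit_iff_isUnit_det, det_mul] at hu
    exact (Matrix.isUnit_iff_isUnit_det S).2 (isUnit_of_mul_isUnit_left hu)
  have hSd : IsUnit S.det := (Matrix.isUnit_iff_isUnit_det S).1 hSu
  have hT : (S⁻¹ * G * (S⁻¹)ᴴ).IsHermitian := by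
    simp only [IsHermitian, conjTranspose_mul, conjTranspose_conjTranspose, hG.eq, Matrix.mul_assoc]
  set V : Matrix ι ι ℂ := (hT.eigenvectorUnitary : Matrix ι ι ℂ) with hV
  have hVV : V * Vᴴ = 1 := by
    have := (mem_unitaryGroup_iff (A := V)).1 hT.eigenvectorUnitary.2
    simpa [star_eq_conjTranspose] using this
  have hspec : S⁻¹ * G * (S⁻¹)ᴴ = V * diagonal (fun i => (hT.eigenvalues i : ℂ)) * Vᴴ := by
    conv_lhs => rw [hT.spectral_theorem]
    simp [Unitary.conjStarAlgAut_apply, hV, star_eq_conjTranspose, Function.comp_def]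
  have hSS : Sᴴ⁻¹ * Sᴴ = 1 := nonsing_inv_mul _ (by rw [det_conjTranspose]; exact hSd.star)
  refine ⟨S * V, hT.eigenvalues, ?_, ?_, ?_⟩
  · refine hSu.mul ((Matrix.isUnit_iff_isUnit_det V).2 ?_)
    have := congrArg det hVV
    rw [det_mul, det_one] at this
    exact IsUnit.of_mul_eq_one _ this
  · rw [hS, conjTranspose_mul, Matrix.mul_assoc, ← Matrix.mul_assoc V, hVV, Matrix.one_mul]
  · calc G = S * (S⁻¹ * G * (S⁻¹)ᴴ) * Sᴴ := by
          rw [conjTranspose_nonsing_inv]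
          simp only [Matrix.mul_assoc]
          rw [hSS, Matrix.mul_one, ← Matrix.mul_assoc, mul_nonsing_inv _ hSd, Matrix.one_mul]
      _ = S * (V * diagonal (fun i => (hT.eigenvalues i : ℂ)) * Vᴴ) * Sᴴ :=
          congrArg (fun T => S * T * Sᴴ) hspec
      _ = _ := by rw [conjTranspose_mul]; simp only [Matrix.mul_assoc]

theorem isUnit_det_of_isUnit {R : Matrix ι ι ℂ} (hR : IsUnit R) : IsUnit R.det :=
  (Matrix.isUnit_iff_isUnit_det R).1 hR

theorem isUnit_det_conjTranspose {R : Matrix ι ι ℂ} (hR : IsUnit R) : IsUnit Rᴴ.det := by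
  rw [det_conjTranspose]; exact (isUnit_det_of_isUnit hR).star

/-- Similarity by `Rᴴ` turns `X R Rᴴ` into `Rᴴ X R`. -/
theorem charpoly_mul_self_conjTranspose (R X : Matrix ι ι ℂ) :
    (X * (R * Rᴴ)).charpoly = (Rᴴ * X * R).charpoly := by
  rw [← Matrix.mul_assoc, charpoly_mul_comm, Matrix.mul_assoc]

theorem trace_mul_mul_self_conjTranspose {ι κ : Type*} [Fintype ι] [Fintype κ] (R X : Matrix ι ι ℂ)
    (Z : Matrix ι κ ℂ) :
    (X * ((R * Z) * (R * Z)ᴴ)).trace = ((Rᴴ * X * R) * (Z * Zᴴ)).trace := by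
  rw [conjTranspose_mul, ← Matrix.mul_assoc, ← Matrix.mul_assoc, trace_mul_comm]
  simp only [Matrix.mul_assoc]

theorem re_trace_diagonal_mul {κ : Type*} [Fintype κ] (d : ι → ℝ) (z : ι → κ → ℂ) :
    (diagonal (fun i => (d i : ℂ)) * (Matrix.of z * (Matrix.of z)ᴴ)).trace.re
      = ∑ i, d i * ∑ l, ‖z i l‖ ^ 2 := by
  simp only [trace, diag_apply, diagonal_mul, mul_apply (M := Matrix.of z), Complex.re_sum,
    of_apply, conjTranspose_apply, Complex.re_ofReal_mul]
  refine Finset.sum_congr rfl fun i _ => congrArg (d i * ·) (Finset.sum_congr rfl fun l _ => ?_)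
  rw [← starRingEnd_apply, Complex.mul_conj, Complex.ofReal_re, Complex.normSq_eq_norm_sq]

end Diagonalisation

/-! ### Densities of product measures -/

section Product

theorem lintegral_fintype_prod_eq_prod {ι : Type*} [Fintype ι] {α : Type*} [MeasurableSpace α]
    (μ : Measure α) [SigmaFinite μ] (f : ι → α → ENNReal) (hf : ∀ i, Measurable (f i)) :
    ∫⁻ x : ι → α, ∏ i, f i (x i) ∂(Measure.pi fun _ => μ) = ∏ i, ∫⁻ x, f i x ∂μ := by
  have key : ∀ (n : ℕ) (f : Fin n → α → ENNReal), (∀ i, Measurable (f i)) →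
      ∫⁻ x : Fin n → α, ∏ i, f i (x i) ∂(Measure.pi fun _ => μ) = ∏ i, ∫⁻ x, f i x ∂μ := by
    intro n
    induction n with
    | zero => intro f hf; simp [lintegral_const]
    | succ n ih =>
      intro f hf
      rw [← ((measurePreserving_piFinSuccAbove (fun _ : Fin (n + 1) => μ) 0).symm).lintegral_comp_emb
        (MeasurableEquiv.measurableEmbedding _)]
      simp_rw [MeasurableEquiv.piFinSuccAbove_symm_apply, Fin.insertNthEquiv,
            Fin.prod_univ_succ, Fin.insertNth_zero, Equiv.coe_fn_mk, Fin.cons_succ, Fin.cons_zero]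
      rw [← ih (fun i => f i.succ) fun i => hf i.succ]
      exact lintegral_prod_mul (hf 0).aemeasurable
        (Finset.measurable_prod _ fun (i : Fin n) _ => (hf i.succ).comp (measurable_pi_apply i)).aemeasurable
  let e := (Fintype.equivFin ι).symm
  rw [← (measurePreserving_piCongrLeft (fun _ : ι => μ) e).lintegral_comp_emb
    (MeasurableEquiv.measurableEmbedding _)]
  simp_rw [← e.prod_comp, MeasurableEquiv.coe_piCongrLeft, Equiv.piCongrLeft_apply_apply]
  exact key _ _ fun i => hf _

theorem pi_withDensity {ι : Type*} [Fintype ι] {α : Type*} [MeasurableSpace α]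
    (μ : Measure α) [SigmaFinite μ] {f : α → ENNReal} (hf : Measurable f)
    [SigmaFinite (μ.withDensity f)] :
    (Measure.pi fun _ : ι => μ.withDensity f) =
      (Measure.pi fun _ : ι => μ).withDensity fun x => ∏ i, f (x i) := by
  refine Measure.pi_eq fun s hs => ?_
  rw [withDensity_apply _ (MeasurableSet.univ_pi hs), ← lintegral_indicator
    (MeasurableSet.univ_pi hs)]
  have h : ∀ x : ι → α, (Set.univ.pi s).indicator (fun x => ∏ i, f (x i)) x
      = ∏ i, (s i).indicator f (x i) := by
    intro x
    by_cases hx : x ∈ Set.univ.pi s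
    · rw [Set.indicator_of_mem hx]
      exact Finset.prod_congr rfl fun i _ => (Set.indicator_of_mem (hx i trivial) _).symm
    · rw [Set.indicator_of_notMem hx]
      obtain ⟨i, hi⟩ : ∃ i, x i ∉ s i := by simpa [Set.mem_pi] using hx
      exact (Finset.prod_eq_zero (Finset.mem_univ i) (Set.indicator_of_notMem hi _)).symm
  simp_rw [h]
  rw [lintegral_fintype_prod_eq_prod μ _ fun i => hf.indicator (hs i)]
  exact Finset.prod_congr rfl fun i _ => by
    rw [lintegral_indicator (hs i), withDensity_apply _ (hs i)]

end Product

/-! ### The complex Gaussian law -/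

section Gaussian

theorem measurable_mk_complex : Measurable fun p : ℝ × ℝ => (⟨p.1, p.2⟩ : ℂ) :=
  Complex.measurableEquivRealProd.symm.measurable

instance instProbabilityComplexGaussian (v : ℝ) : IsProbabilityMeasure (complexGaussian v) :=
  Measure.isProbabilityMeasure_map measurable_mk_complex.aemeasurable

instance instProbabilityIidGaussian (ι κ : Type) [Fintype ι] [Fintype κ] (v : ℝ) :
    IsProbabilityMeasure (iidGaussian ι κ v) := by
  unfold iidGaussian; infer_instance

/-- The density of `CN(0, v)` with respect to Lebesgue measure. -/
noncomputable def cgDensity (v : ℝ) (z : ℂ) : ℝ := (Real.pi * v)⁻¹ * Real.exp (-‖z‖ ^ 2 / v)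

theorem measurable_cgDensity (v : ℝ) : Measurable (cgDensity v) := by
  unfold cgDensity; fun_prop

theorem cgDensity_nonneg {v : ℝ} (hv : 0 < v) (z : ℂ) : 0 ≤ cgDensity v z := by
  unfold cgDensity; positivity

theorem complexGaussian_eq_withDensity {v : ℝ} (hv : 0 < v) :
    complexGaussian v = volume.withDensity fun z => ENNReal.ofReal (cgDensity v z) := by
  have hv' : (v / 2).toNNReal ≠ 0 := by simpa using hv
  have hmp := Complex.volume_preserving_equiv_real_prod
  rw [complexGaussian, gaussianReal_of_var_ne_zero _ hv',
    prod_withDensity (measurable_gaussianPDF _ _) (measurable_gaussianPDF _ _)]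
  ext s hs
  rw [Measure.map_apply measurable_mk_complex hs, withDensity_apply _ (measurable_mk_complex hs),
    withDensity_apply _ hs, ← hmp.symm.setLIntegral_comp_preimage_emb
      (MeasurableEquiv.measurableEmbedding _)]
  refine lintegral_congr fun p => ?_
  have hc : ((v / 2).toNNReal : ℝ) = v / 2 := Real.coe_toNNReal _ (by positivity)
  simp only [gaussianPDF, gaussianPDFReal, cgDensity, hc]
  rw [← ENNReal.ofReal_mul (by positivity)]
  congr 1
  have hn : ‖Complex.measurableEquivRealProd.symm p‖ ^ 2 = p.1 ^ 2 + p.2 ^ 2 := by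
    rw [← Complex.normSq_eq_norm_sq, Complex.normSq_apply]
    simp [Complex.measurableEquivRealProd]
    ring
  rw [hn]
  have h2 : (√(2 * Real.pi * (v / 2)))⁻¹ * (√(2 * Real.pi * (v / 2)))⁻¹ = (Real.pi * v)⁻¹ := by
    rw [← mul_inv, Real.mul_self_sqrt (by positivity)]
    congr 1; ring
  rw [mul_mul_mul_comm, h2, ← Real.exp_add]
  congr 2
  field_simp
  ring

theorem integral_complexGaussian {v : ℝ} (hv : 0 < v) (f : ℂ → ℂ) :
    ∫ z, f z ∂(complexGaussian v) = ∫ z, (cgDensity v z : ℂ) * f z := by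
  rw [complexGaussian_eq_withDensity hv, integral_withDensity_eq_integral_toReal_smul
    (measurable_cgDensity v).ennreal_ofReal (by simp)]
  refine integral_congr_ae (ae_of_all _ fun z => ?_)
  simp [ENNReal.toReal_ofReal (cgDensity_nonneg hv z)]

/-- The Laplace transform of `‖z‖²` for `z ∼ CN(0, v)`. -/
theorem integral_cexp_neg_mul_sq_complexGaussian {v : ℝ} (hv : 0 < v) {b : ℂ}
    (hb : 0 < (1 + b * v).re) :
    ∫ z, Complex.exp (-b * ‖z‖ ^ 2) ∂(complexGaussian v) = (1 + b * v)⁻¹ := by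
  rw [integral_complexGaussian hv]
  have hv' : (v : ℂ) ≠ 0 := by exact_mod_cast hv.ne'
  have hpi : (Real.pi : ℂ) ≠ 0 := by exact_mod_cast Real.pi_ne_zero
  have h1 : ∀ z : ℂ, (cgDensity v z : ℂ) * Complex.exp (-b * ‖z‖ ^ 2)
      = (Real.pi * v : ℂ)⁻¹ * Complex.exp (-((1 + b * v) / v) * ‖z‖ ^ 2) := by
    intro z
    simp only [cgDensity]
    push_cast
    rw [mul_assoc, ← Complex.exp_add]
    congr 2
    field_simp
    ring
  simp_rw [h1]
  have hre : 0 < ((1 + b * v) / v : ℂ).re := by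
    rw [Complex.div_ofReal_re]; exact div_pos hb hv
  have hne : (1 + b * v : ℂ) ≠ 0 := fun h => by simp [h] at hb
  rw [integral_const_mul, GaussianFourier.integral_cexp_neg_mul_sq_norm hre]
  simp only [Complex.finrank_real_complex]
  norm_num
  field_simp

/-- The characteristic function of `CN(0, v)`. -/
theorem integral_cexp_re_complexGaussian {v : ℝ} (hv : 0 < v) (s : ℂ) :
    ∫ z : ℂ, Complex.exp ((star s * z).re * Complex.I) ∂(complexGaussian v)
      = Complex.exp (-(v * ‖s‖ ^ 2 / 4 : ℝ)) := by
  rw [integral_complexGaussian hv]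
  have hv' : (v : ℂ) ≠ 0 := by exact_mod_cast hv.ne'
  have hpi : (Real.pi : ℂ) ≠ 0 := by exact_mod_cast Real.pi_ne_zero
  have h1 : ∀ z : ℂ, (cgDensity v z : ℂ) * Complex.exp ((star s * z).re * Complex.I)
      = (Real.pi * v : ℂ)⁻¹ * Complex.exp (-(1 / v : ℂ) * ‖z‖ ^ 2
        + Complex.I * (inner ℝ s z : ℝ)) := by
    intro z
    simp only [cgDensity]
    push_cast
    rw [mul_assoc, ← Complex.exp_add, Complex.inner, mul_comm Complex.I,
      starRingEnd_apply, mul_comm z (star s)]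
    congr 2
    field_simp
  simp_rw [h1]
  have hre : 0 < (1 / v : ℂ).re := by
    rw [Complex.div_ofReal_re]; simpa using hv
  rw [integral_const_mul, GaussianFourier.integral_cexp_neg_mul_sq_norm_add hre]
  simp only [Complex.finrank_real_complex, Complex.I_sq]
  push_cast
  norm_num
  field_simp

end Gaussian

/-! ### Linear images of Gaussian matrices -/

section LinearImage

variable {ι κ τ : Type} [Fintype ι] [Fintype κ] [Fintype τ]

theorem integral_iidGaussian_prod {v : ℝ} (f : ι → κ → ℂ → ℂ) :
    ∫ z, ∏ i, ∏ l, f i l (z i l) ∂(iidGaussian ι κ v)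
      = ∏ i, ∏ l, ∫ z, f i l z ∂(complexGaussian v) := by
  rw [iidGaussian, integral_fintype_prod_eq_prod fun i (x : κ → ℂ) => ∏ l, f i l (x l)]
  exact Finset.prod_congr rfl fun i _ => integral_fintype_prod_eq_prod _

/-- The characteristic function of a matrix with i.i.d. `CN(0, v)` entries. -/
theorem integral_cexp_iidGaussian {v : ℝ} (hv : 0 < v) (s : ι → κ → ℂ) :
    ∫ z, Complex.exp ((∑ i, ∑ l, (star (s i l) * z i l).re : ℝ) * Complex.I) ∂(iidGaussian ι κ v)
      = Complex.exp (-(v / 4 * ∑ i, ∑ l, ‖s i l‖ ^ 2 : ℝ)) := by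
  have h : ∀ z : ι → κ → ℂ,
      Complex.exp ((∑ i, ∑ l, (star (s i l) * z i l).re : ℝ) * Complex.I)
        = ∏ i, ∏ l, Complex.exp ((star (s i l) * z i l).re * Complex.I) := by
    intro z
    simp only [← Complex.exp_sum]
    push_cast
    simp only [Finset.sum_mul]
  simp_rw [h]
  rw [integral_iidGaussian_prod fun i l z => Complex.exp ((star (s i l) * z).re * Complex.I)]
  simp only [integral_cexp_re_complexGaussian hv, ← Complex.exp_sum]
  congr 1
  push_cast
  simp only [Finset.mul_sum, ← Finset.sum_neg_distrib]
  exact Finset.sum_congr rfl fun i _ => Finset.sum_congr rfl fun l _ => by ring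

/-- Every real-linear functional is the real part of a Frobenius inner product. -/
theorem exists_dual_repr (ψ : StrongDual ℝ (ι → κ → ℂ)) :
    ∃ s : ι → κ → ℂ, ∀ y, ψ y = ∑ i, ∑ l, (star (s i l) * y i l).re := by
  classical
  refine ⟨fun i l => ⟨ψ (Pi.single i (Pi.single l 1)), ψ (Pi.single i (Pi.single l Complex.I))⟩,
    fun y => ?_⟩
  have hy : y = ∑ i, ∑ l, ((y i l).re • (Pi.single i (Pi.single l (1 : ℂ)) : ι → κ → ℂ)
      + (y i l).im • (Pi.single i (Pi.single l Complex.I) : ι → κ → ℂ)) := by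
    ext i l
    simp only [Finset.sum_apply, Pi.add_apply, Pi.smul_apply]
    rw [Finset.sum_eq_single i, Finset.sum_eq_single l]
    · simp
    · intro b _ hb; simp [Pi.single_eq_of_ne hb.symm]
    · simp
    · intro b _ hb; simp [Pi.single_eq_of_ne hb.symm]
    · simp
  conv_lhs => rw [hy]
  simp only [map_sum, map_add, map_smul, smul_eq_mul]
  refine Finset.sum_congr rfl fun i _ => Finset.sum_congr rfl fun l _ => ?_
  simp [Complex.mul_re]
  ring

/-- For the real part of the Frobenius inner product, multiplication by `Cᴴ` is the adjoint of
multiplication by `C`. -/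
theorem sum_re_star_mul_mul (C : Matrix ι τ ℂ) (s : ι → κ → ℂ) (h : τ → κ → ℂ) :
    ∑ i, ∑ l, (star (s i l) * (C * Matrix.of h) i l).re
      = ∑ j, ∑ l, (star ((Cᴴ * Matrix.of s) j l) * h j l).re := by
  simp only [mul_apply, star_sum, Finset.mul_sum, Finset.sum_mul, Complex.re_sum, of_apply,
    conjTranspose_apply, star_mul', star_star]
  calc _ = ∑ i, ∑ j, ∑ l, (star (s i l) * (C i j * h j l)).re :=
        Finset.sum_congr rfl fun i _ => Finset.sum_comm
    _ = ∑ j, ∑ i, ∑ l, (star (s i l) * (C i j * h j l)).re := Finset.sum_comm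
    _ = _ := Finset.sum_congr rfl fun j _ => by
        rw [Finset.sum_comm]
        exact Finset.sum_congr rfl fun l _ => Finset.sum_congr rfl fun i _ => by ring_nf

theorem sum_norm_sq_eq_trace (S : Matrix ι κ ℂ) :
    ∑ i, ∑ l, ‖S i l‖ ^ 2 = (Sᴴ * S).trace.re := by
  simp only [trace, diag_apply, mul_apply, Complex.re_sum, conjTranspose_apply]
  rw [Finset.sum_comm]
  refine Finset.sum_congr rfl fun l _ => Finset.sum_congr rfl fun i _ => ?_
  rw [← starRingEnd_apply, mul_comm, Complex.mul_conj, Complex.ofReal_re,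
    Complex.normSq_eq_norm_sq]

theorem measurable_matrix_mul_of {ι κ τ : Type} [Fintype τ] (C : Matrix ι τ ℂ) :
    Measurable fun h : τ → κ → ℂ => (fun i l => (C * Matrix.of h) i l) := by
  refine measurable_pi_lambda _ fun i => measurable_pi_lambda _ fun l => ?_
  simp only [mul_apply, of_apply]
  fun_prop

/-- The signal plus noise `C h + z` has the law of any `R z'` with `R Rᴴ = I + C Cᴴ`: both are
centred Gaussian with independent columns of covariance `I + C Cᴴ`. -/
theorem map_add_eq_map_mul [DecidableEq ι] (C : Matrix ι τ ℂ) (R : Matrix ι ι ℂ)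
    (hR : R * Rᴴ = 1 + C * Cᴴ) :
    ((iidGaussian τ κ 1).prod (iidGaussian ι κ 1)).map
        (fun p i l => (C * Matrix.of p.1) i l + p.2 i l)
      = (iidGaussian ι κ 1).map fun z i l => (R * Matrix.of z) i l := by
  have hm1 : Measurable fun p : (τ → κ → ℂ) × (ι → κ → ℂ) =>
      (fun i l => (C * Matrix.of p.1) i l + p.2 i l) :=
    ((measurable_matrix_mul_of C).comp measurable_fst).add measurable_snd
  have hm2 := measurable_matrix_mul_of (κ := κ) R
  have := Measure.isProbabilityMeasure_map (μ := (iidGaussian τ κ 1).prod (iidGaussian ι κ 1))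
    hm1.aemeasurable
  have := Measure.isProbabilityMeasure_map (μ := iidGaussian ι κ 1) hm2.aemeasurable
  refine Measure.ext_of_charFunDual (funext fun ψ => ?_)
  obtain ⟨s, hs⟩ := exists_dual_repr ψ
  have hψ : Continuous fun y : ι → κ → ℂ => Complex.exp (ψ y * Complex.I) := by fun_prop
  rw [charFunDual_apply, charFunDual_apply, integral_map hm1.aemeasurable
    hψ.aestronglyMeasurable, integral_map hm2.aemeasurable hψ.aestronglyMeasurable]
  simp only [hs, sum_re_star_mul_mul, mul_add, Complex.add_re, Finset.sum_add_distrib,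
    Complex.ofReal_add, add_mul, Complex.exp_add]
  rw [integral_prod_mul (fun x : τ → κ → ℂ => Complex.exp
      ((∑ j, ∑ l, (star ((Cᴴ * Matrix.of s) j l) * x j l).re : ℝ) * Complex.I))
      (fun z : ι → κ → ℂ => Complex.exp ((∑ i, ∑ l, (star (s i l) * z i l).re : ℝ) * Complex.I)),
    integral_cexp_iidGaussian one_pos fun j l => (Cᴴ * Matrix.of s) j l,
    integral_cexp_iidGaussian one_pos s,
    integral_cexp_iidGaussian one_pos fun j l => (Rᴴ * Matrix.of s) j l, ← Complex.exp_add]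
  congr 1
  have e1 := sum_norm_sq_eq_trace (Cᴴ * Matrix.of s)
  have e2 := sum_norm_sq_eq_trace (Rᴴ * Matrix.of s)
  have e3 := sum_norm_sq_eq_trace (Matrix.of s)
  simp only [of_apply] at e3
  rw [e1, e2, e3]
  have e4 : (Rᴴ * Matrix.of s)ᴴ * (Rᴴ * Matrix.of s)
      = (Matrix.of s)ᴴ * Matrix.of s + (Cᴴ * Matrix.of s)ᴴ * (Cᴴ * Matrix.of s) := by
    simp only [conjTranspose_mul, conjTranspose_conjTranspose, Matrix.mul_assoc]
    rw [← Matrix.mul_assoc R, hR, ← Matrix.mul_assoc C, Matrix.add_mul, Matrix.mul_add,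
      Matrix.one_mul]
  rw [e4, trace_add, Complex.add_re]
  push_cast
  ring

end LinearImage

/-! ### Laplace transforms and the gamma law of the squared norm -/

section Gamma

variable {ι κ : Type} [Fintype ι] [Fintype κ]

theorem integral_cexp_neg_sum_iidGaussian {v : ℝ} (hv : 0 < v) {b : ι → ℂ}
    (hb : ∀ i, 0 < (1 + b i * v).re) :
    ∫ z, Complex.exp (-∑ i, b i * ∑ l, (‖z i l‖ : ℂ) ^ 2) ∂(iidGaussian ι κ v)
      = (∏ i, (1 + b i * v)⁻¹) ^ Fintype.card κ := by
  have h : ∀ z : ι → κ → ℂ, Complex.exp (-∑ i, b i * ∑ l, (‖z i l‖ : ℂ) ^ 2)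
      = ∏ i, ∏ l, Complex.exp (-b i * ‖z i l‖ ^ 2) := by
    intro z
    simp only [← Complex.exp_sum, Finset.mul_sum, ← Finset.sum_neg_distrib, neg_mul]
  simp_rw [h]
  rw [integral_iidGaussian_prod fun i _ z => Complex.exp (-b i * ‖z‖ ^ 2)]
  simp only [integral_cexp_neg_mul_sq_complexGaussian hv (hb _), Finset.prod_const,
    Finset.card_univ, Finset.prod_pow]

/-- The Laplace transform of a diagonal quadratic form in a standard Gaussian matrix. -/
theorem lintegral_exp_neg_sum_iidGaussian {d : ι → ℝ} (hd : ∀ i, 0 < d i) :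
    ∫⁻ z, ENNReal.ofReal (Real.exp (-∑ i, (d i - 1) * ∑ l, ‖z i l‖ ^ 2)) ∂(iidGaussian ι κ 1)
      = ENNReal.ofReal ((∏ i, d i)⁻¹ ^ Fintype.card κ) := by
  have h := integral_cexp_neg_sum_iidGaussian (ι := ι) (κ := κ) one_pos
    (b := fun i => ((d i - 1 : ℝ) : ℂ)) (fun i => by simpa using hd i)
  have hE : ∫ z, Real.exp (-∑ i, (d i - 1) * ∑ l, ‖z i l‖ ^ 2) ∂(iidGaussian ι κ 1)
      = (∏ i, d i)⁻¹ ^ Fintype.card κ := by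
    have h2 : ∀ z : ι → κ → ℂ, Complex.exp (-∑ i, ((d i - 1 : ℝ) : ℂ) * ∑ l, (‖z i l‖ : ℂ) ^ 2)
        = ((Real.exp (-∑ i, (d i - 1) * ∑ l, ‖z i l‖ ^ 2) : ℝ) : ℂ) := by
      intro z; push_cast; rfl
    simp_rw [h2] at h
    rw [integral_complex_ofReal] at h
    apply Complex.ofReal_injective
    rw [h]
    push_cast
    simp
  have hpos : 0 < (∏ i, d i)⁻¹ ^ Fintype.card κ :=
    pow_pos (inv_pos.2 (Finset.prod_pos fun i _ => hd i)) _
  have hint : Integrable (fun z : ι → κ → ℂ => Real.exp (-∑ i, (d i - 1) * ∑ l, ‖z i l‖ ^ 2))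
      (iidGaussian ι κ 1) := by
    -- The integral of a function that is not integrable is `0`, but this one is positive.
    by_contra hc
    rw [integral_undef hc] at hE
    exact hpos.ne hE
  rw [← hE, ofReal_integral_eq_lintegral_ofReal hint (ae_of_all _ fun z => (Real.exp_pos _).le)]

theorem integrableOn_pow_mul_cexp {z : ℂ} (hz : 0 < z.re) (N : ℕ) :
    IntegrableOn (fun t : ℝ => (t : ℂ) ^ N * Complex.exp (-z * t)) (Set.Ioi 0) := by
  have h := integrableOn_rpow_mul_exp_neg_mul_rpow (s := N) (p := 1) (b := z.re)
    (by have : (0 : ℝ) ≤ N := N.cast_nonneg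
        linarith) one_pos hz
  refine Integrable.mono' h (by fun_prop) ?_
  refine (ae_restrict_iff' measurableSet_Ioi).2 (ae_of_all _ fun t ht => ?_)
  have ht0 : (0 : ℝ) ≤ t := le_of_lt ht
  rw [norm_mul, norm_pow, Complex.norm_real, Real.norm_of_nonneg ht0, Complex.norm_exp,
    Real.rpow_natCast, Real.rpow_one]
  simp

/-- `∫₀^∞ t ^ N e ^ (-z t) dt = N! / z ^ (N + 1)` for complex `z` in the right half plane. -/
theorem integral_pow_mul_cexp_Ioi {z : ℂ} (hz : 0 < z.re) (N : ℕ) :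
    ∫ t : ℝ in Set.Ioi 0, (t : ℂ) ^ N * Complex.exp (-z * t) = N.factorial * z⁻¹ ^ (N + 1) := by
  have hz0 : z ≠ 0 := fun h => by simp [h] at hz
  induction N with
  | zero =>
    have := integral_exp_mul_complex_Ioi (a := -z) (by simpa using hz) 0
    simpa using this
  | succ N ih =>
    have hu : ∀ t ∈ Set.Ioi (0 : ℝ), HasDerivAt (fun t : ℝ => (t : ℂ) ^ (N + 1))
        ((N + 1 : ℂ) * (t : ℂ) ^ N) t := fun t _ => by
      have := (hasDerivAt_pow (N + 1) (t : ℂ)).comp_ofReal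
      simpa using this
    have hv : ∀ t ∈ Set.Ioi (0 : ℝ), HasDerivAt (fun t : ℝ => -z⁻¹ * Complex.exp (-z * t))
        (Complex.exp (-z * t)) t := fun t _ => by
      have h1 : HasDerivAt (fun w : ℂ => -z⁻¹ * Complex.exp (-z * w))
          (-z⁻¹ * (Complex.exp (-z * t) * (-z * 1))) (t : ℂ) :=
        (((hasDerivAt_id (t : ℂ)).const_mul (-z)).cexp).const_mul (-z⁻¹)
      convert h1.comp_ofReal using 1
      field_simp
    have h0 : Filter.Tendsto
        ((fun t : ℝ => (t : ℂ) ^ (N + 1)) * fun t : ℝ => -z⁻¹ * Complex.exp (-z * t))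
        (nhdsWithin 0 (Set.Ioi 0)) (nhds 0) := by
      have hc : Continuous ((fun t : ℝ => (t : ℂ) ^ (N + 1)) *
          fun t : ℝ => -z⁻¹ * Complex.exp (-z * t)) := by fun_prop
      have := hc.tendsto 0
      simp only [Pi.mul_apply, Complex.ofReal_zero, ne_eq, Nat.add_eq_zero_iff, one_ne_zero,
        and_false, not_false_eq_true, zero_pow, zero_mul] at this
      exact this.mono_left nhdsWithin_le_nhds
    have hinf : Filter.Tendsto
        ((fun t : ℝ => (t : ℂ) ^ (N + 1)) * fun t : ℝ => -z⁻¹ * Complex.exp (-z * t))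
        Filter.atTop (nhds 0) := by
      rw [tendsto_zero_iff_norm_tendsto_zero]
      have h1 := (tendsto_rpow_mul_exp_neg_mul_atTop_nhds_zero ((N + 1 : ℕ) : ℝ) z.re hz).const_mul
        ‖z⁻¹‖
      rw [mul_zero] at h1
      refine h1.congr' ?_
      filter_upwards [Filter.eventually_ge_atTop (0 : ℝ)] with t ht
      simp only [Pi.mul_apply, norm_mul, norm_pow, Complex.norm_real, Real.norm_of_nonneg ht,
        Complex.norm_exp, Real.rpow_natCast, norm_neg]
      simp
      ring
    have key := integral_Ioi_mul_deriv_eq_deriv_mul (a := 0) hu hv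
      (integrableOn_pow_mul_cexp hz (N + 1))
      (by
        refine (((integrableOn_pow_mul_cexp hz N).const_mul (-(N + 1) * z⁻¹))).congr
          (ae_of_all _ fun t => ?_)
        simp only [Pi.mul_apply]; ring) h0 hinf
    rw [key]
    have h2 : ∀ t : ℝ, ((N + 1 : ℂ) * (t : ℂ) ^ N) * (-z⁻¹ * Complex.exp (-z * t))
        = (-(N + 1) * z⁻¹) * ((t : ℂ) ^ N * Complex.exp (-z * t)) := fun t => by ring
    simp_rw [h2]
    rw [integral_const_mul, ih, Nat.factorial_succ]
    push_cast
    ring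

theorem charFun_gammaMeasure {N : ℕ} (hN : 0 < N) {v : ℝ} (hv : 0 < v) (t : ℝ) :
    charFun (gammaMeasure N v⁻¹) t = (1 - v * t * Complex.I)⁻¹ ^ N := by
  obtain ⟨N, rfl⟩ : ∃ M, N = M + 1 := ⟨N - 1, by omega⟩
  have hv' : (v : ℂ) ≠ 0 := by exact_mod_cast hv.ne'
  rw [charFun_apply_real, gammaMeasure, integral_withDensity_eq_integral_toReal_smul
    (by unfold gammaPDF; fun_prop) (by simp [gammaPDF])]
  have hz : 0 < ((v : ℂ)⁻¹ - t * Complex.I).re := by simpa using hv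
  have hind : ∀ᵐ x : ℝ, (gammaPDF (↑(N + 1)) v⁻¹ x).toReal • Complex.exp (t * x * Complex.I)
      = (Set.Ioi (0 : ℝ)).indicator (fun x : ℝ => ((v : ℂ)⁻¹ ^ (N + 1) / N.factorial) *
        ((x : ℂ) ^ N * Complex.exp (-((v : ℂ)⁻¹ - t * Complex.I) * x))) x := by
    filter_upwards [Measure.ae_ne volume (0 : ℝ)] with x hx0
    by_cases hx : 0 < x
    · rw [Set.indicator_of_mem (Set.mem_Ioi.2 hx), gammaPDF_of_nonneg hx.le,
        ENNReal.toReal_ofReal (by positivity)]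
      have h1 : -((v : ℂ)⁻¹ - t * Complex.I) * x = -((v : ℂ)⁻¹ * x) + t * x * Complex.I := by ring
      rw [h1, Complex.exp_add]
      push_cast
      rw [Real.Gamma_nat_eq_factorial, add_sub_cancel_right, Real.rpow_natCast,
        ← Nat.cast_succ, Real.rpow_natCast, Complex.real_smul]
      push_cast
      rw [Nat.succ_eq_add_one]
      ring
    · rw [Set.indicator_of_notMem (by simpa using hx), gammaPDF_of_neg
        (lt_of_le_of_ne (not_lt.1 hx) hx0)]
      simp
  rw [integral_congr_ae hind, integral_indicator measurableSet_Ioi, integral_const_mul,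
    integral_pow_mul_cexp_Ioi hz]
  have hf : (N.factorial : ℂ) ≠ 0 := by exact_mod_cast N.factorial_ne_zero
  rw [← mul_assoc, div_mul_cancel₀ _ hf, ← mul_pow, ← mul_inv]
  congr 2
  field_simp

theorem integral_cexp_normSq_pi {v : ℝ} (hv : 0 < v) (t : ℝ) :
    ∫ z : ι → ℂ, Complex.exp (t * (∑ i, ‖z i‖ ^ 2 : ℝ) * Complex.I)
        ∂(Measure.pi fun _ => complexGaussian v)
      = (1 - v * t * Complex.I)⁻¹ ^ Fintype.card ι := by
  have h : ∀ z : ι → ℂ, Complex.exp (t * (∑ i, ‖z i‖ ^ 2 : ℝ) * Complex.I)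
      = ∏ i, Complex.exp (-(-t * Complex.I) * ‖z i‖ ^ 2) := by
    intro z
    rw [← Complex.exp_sum]
    push_cast
    simp only [Finset.mul_sum, Finset.sum_mul]
    exact congrArg _ (Finset.sum_congr rfl fun i _ => by ring)
  simp_rw [h]
  rw [integral_fintype_prod_eq_prod fun (_ : ι) z => Complex.exp (-(-t * Complex.I) * ‖z‖ ^ 2),
    Finset.prod_const, Finset.card_univ,
    integral_cexp_neg_mul_sq_complexGaussian hv (by simp)]
  congr 2
  ring

/-- The squared norm of a vector with i.i.d. `CN(0, v)` entries is gamma distributed. -/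
theorem map_normSq_pi [Nonempty ι] {v : ℝ} (hv : 0 < v) :
    (Measure.pi fun _ : ι => complexGaussian v).map (fun z => ∑ i, ‖z i‖ ^ 2)
      = gammaMeasure (Fintype.card ι) v⁻¹ := by
  have hm : Measurable fun z : ι → ℂ => ∑ i, ‖z i‖ ^ 2 := by fun_prop
  have := Measure.isProbabilityMeasure_map
    (μ := Measure.pi fun _ : ι => complexGaussian v) hm.aemeasurable
  have := isProbabilityMeasure_gammaMeasure
    (a := Fintype.card ι) (by exact_mod_cast Fintype.card_pos) (inv_pos.2 hv)
  refine Measure.ext_of_charFun (funext fun t => ?_)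
  rw [charFun_gammaMeasure Fintype.card_pos hv, charFun_apply_real,
    integral_map hm.aemeasurable (by fun_prop), integral_cexp_normSq_pi hv]

/-- The squared Frobenius norm of a matrix with i.i.d. `CN(0, v)` entries is gamma distributed. -/
theorem map_normSq_iidGaussian [Nonempty ι] [Nonempty κ] {v : ℝ} (hv : 0 < v) :
    (iidGaussian ι κ v).map (fun z => ∑ i, ∑ l, ‖z i l‖ ^ 2)
      = gammaMeasure ((Fintype.card ι * Fintype.card κ : ℕ) : ℝ) v⁻¹ := by
  have hm : Measurable fun z : ι → κ → ℂ => ∑ i, ∑ l, ‖z i l‖ ^ 2 := by fun_prop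
  have hpos : 0 < Fintype.card ι * Fintype.card κ := Nat.mul_pos Fintype.card_pos Fintype.card_pos
  have := Measure.isProbabilityMeasure_map (μ := iidGaussian ι κ v) hm.aemeasurable
  have := isProbabilityMeasure_gammaMeasure
    (a := ((Fintype.card ι * Fintype.card κ : ℕ) : ℝ)) (by exact_mod_cast hpos) (inv_pos.2 hv)
  refine Measure.ext_of_charFun (funext fun t => ?_)
  rw [charFun_gammaMeasure hpos hv, charFun_apply_real,
    integral_map hm.aemeasurable (by fun_prop)]
  have h : ∀ z : ι → κ → ℂ, Complex.exp (t * (∑ i, ∑ l, ‖z i l‖ ^ 2 : ℝ) * Complex.I)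
      = ∏ i, Complex.exp (t * (∑ l, ‖z i l‖ ^ 2 : ℝ) * Complex.I) := by
    intro z
    rw [← Complex.exp_sum]
    push_cast
    simp only [Finset.mul_sum, Finset.sum_mul]
  simp_rw [h]
  rw [iidGaussian, integral_fintype_prod_eq_prod fun (_ : ι) (x : κ → ℂ) =>
    Complex.exp (t * (∑ l, ‖x l‖ ^ 2 : ℝ) * Complex.I), Finset.prod_const, Finset.card_univ,
    integral_cexp_normSq_pi hv, ← pow_mul, mul_comm (Fintype.card κ)]

theorem regGamma_of_nonpos (a : ℝ) {x : ℝ} (hx : x ≤ 0) : regGamma a x = 0 := by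
  simp [regGamma, Set.Ioc_eq_empty (not_lt.2 hx)]

/-- `γ(a, x / v) / Γ(a)` is the distribution function of the gamma law with shape `a` and scale `v`,
also for `x ≤ 0`. -/
theorem regGamma_eq_measureReal {a v : ℝ} (ha : 0 < a) (hv : 0 < v) (x : ℝ) :
    (gammaMeasure a v⁻¹).real (Set.Iic x) = regGamma a (x / v) := by
  have hp := isProbabilityMeasure_gammaMeasure ha (inv_pos.2 hv)
  rw [← cdf_eq_real, cdf_gammaMeasure_eq_integral ha (inv_pos.2 hv)]
  rcases le_or_gt x 0 with hx | hx
  · rw [regGamma_of_nonpos _ (div_nonpos_of_nonpos_of_nonneg hx hv.le)]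
    -- The gamma density of Mathlib need not vanish at `0`, which is a null set.
    rw [integral_Iic_eq_integral_Iio]
    exact setIntegral_eq_zero_of_forall_eq_zero fun y (hy : y < x) => by
      simp [gammaPDFReal, not_le.2 (hy.trans_le hx)]
  · have h1 : ∫ y in Set.Iic x, gammaPDFReal a v⁻¹ y
        = ∫ y in (0 : ℝ)..x, v⁻¹ * ((y / v) ^ (a - 1) * Real.exp (-(y / v)) / Real.Gamma a) := by
      rw [intervalIntegral.integral_of_le hx.le, ← integral_indicator measurableSet_Iic,
        ← integral_indicator measurableSet_Ioc]
      refine integral_congr_ae ?_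
      filter_upwards [Measure.ae_ne volume (0 : ℝ)] with y hy0
      by_cases hy : y ≤ x
      · rw [Set.indicator_of_mem (Set.mem_Iic.2 hy)]
        by_cases hy1 : 0 < y
        · rw [Set.indicator_of_mem (Set.mem_Ioc.2 ⟨hy1, hy⟩), gammaPDFReal, if_pos hy1.le,
            Real.div_rpow hy1.le hv.le, Real.inv_rpow hv.le, Real.rpow_sub_one hv.ne']
          have : v ^ a ≠ 0 := (Real.rpow_pos_of_pos hv _).ne'
          rw [div_eq_inv_mul y v]
          field_simp
        · rw [Set.indicator_of_notMem (by simp [hy1]), gammaPDFReal, if_neg]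
          exact not_le.2 (lt_of_le_of_ne (not_lt.1 hy1) hy0)
      · rw [Set.indicator_of_notMem (by simpa using hy), Set.indicator_of_notMem]
        simp [hy]
    rw [h1, intervalIntegral.integral_const_mul, intervalIntegral.integral_comp_div
      (fun y => y ^ (a - 1) * Real.exp (-y) / Real.Gamma a) hv.ne', smul_eq_mul, ← mul_assoc,
      inv_mul_cancel₀ hv.ne', one_mul, zero_div, intervalIntegral.integral_of_le
      (div_nonneg hx.le hv.le), integral_div, regGamma]

theorem regGamma_nonneg {a : ℝ} (ha : 0 < a) (x : ℝ) : 0 ≤ regGamma a x := by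
  have := regGamma_eq_measureReal ha one_pos x
  rw [div_one] at this
  exact this ▸ measureReal_nonneg

theorem regGamma_le_one {a : ℝ} (ha : 0 < a) (x : ℝ) : regGamma a x ≤ 1 := by
  have := regGamma_eq_measureReal ha one_pos x
  have hp := isProbabilityMeasure_gammaMeasure ha (inv_pos.2 one_pos)
  rw [div_one] at this
  exact this ▸ measureReal_le_one

theorem monotone_regGamma {a : ℝ} (ha : 0 < a) : Monotone (regGamma a) := by
  intro x y hxy
  have hx := regGamma_eq_measureReal ha one_pos x
  have hy := regGamma_eq_measureReal ha one_pos y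
  have hp := isProbabilityMeasure_gammaMeasure ha (inv_pos.2 one_pos)
  rw [div_one] at hx hy
  rw [← hx, ← hy]
  exact measureReal_mono (Set.Iic_subset_Iic.2 hxy)

end Gamma

/-! ### Gaussian measure of ellipsoids -/

section Ellipsoid

variable {ι κ : Type} [Fintype ι] [Fintype κ]

/-- Reading i.i.d. variables along an injective index map gives i.i.d. variables. -/
theorem map_comp_pi {ι κ α : Type*} [Fintype ι] [Fintype κ] [MeasurableSpace α] (μ : Measure α)
    [IsProbabilityMeasure μ] {e : κ → ι} (he : e.Injective) :
    (Measure.pi fun _ : ι => μ).map (fun f k => f (e k)) = Measure.pi fun _ : κ => μ := by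
  have h1 : iIndepFun (fun (i : ι) (f : ι → α) => f i) (Measure.pi fun _ : ι => μ) :=
    iIndepFun_pi (X := fun _ => id) fun _ => aemeasurable_id
  have h2 := h1.precomp he
  rw [iIndepFun_iff_map_fun_eq_pi_map fun k => (measurable_pi_apply (e k)).aemeasurable] at h2
  rw [h2]
  congr with k : 1
  exact (measurePreserving_eval (fun _ : ι => μ) (e k)).map_eq

theorem iidGaussian_eq_withDensity {v : ℝ} (hv : 0 < v) :
    iidGaussian ι κ v = volume.withDensity
      fun z => ∏ i, ∏ l, ENNReal.ofReal (cgDensity v (z i l)) := by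
  have hm := (measurable_cgDensity v).ennreal_ofReal
  have h1 : SigmaFinite (volume.withDensity fun z => ENNReal.ofReal (cgDensity v z)) := by
    rw [← complexGaussian_eq_withDensity hv]; infer_instance
  have hpi : (Measure.pi fun _ : κ => complexGaussian v)
      = (Measure.pi fun _ : κ => (volume : Measure ℂ)).withDensity
        fun x => ∏ l, ENNReal.ofReal (cgDensity v (x l)) := by
    rw [complexGaussian_eq_withDensity hv]
    exact pi_withDensity volume hm
  have h2 : SigmaFinite ((Measure.pi fun _ : κ => (volume : Measure ℂ)).withDensity
        fun x => ∏ l, ENNReal.ofReal (cgDensity v (x l))) := by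
    rw [← hpi]; infer_instance
  have hmp : Measurable fun x : κ → ℂ => ∏ l, ENNReal.ofReal (cgDensity v (x l)) :=
    Finset.measurable_prod _ fun l _ => hm.comp (measurable_pi_apply l)
  rw [iidGaussian, hpi, pi_withDensity (Measure.pi fun _ : κ => (volume : Measure ℂ)) hmp]
  rfl

theorem prod_cgDensity_one (z : ι → κ → ℂ) :
    ∏ i, ∏ l, ENNReal.ofReal (cgDensity 1 (z i l)) = ENNReal.ofReal
      ((∏ _i : ι, ∏ _l : κ, Real.pi⁻¹) * Real.exp (-∑ i, ∑ l, ‖z i l‖ ^ 2)) := by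
  have h : ∀ w, 0 ≤ cgDensity 1 w := cgDensity_nonneg one_pos
  simp_rw [← ENNReal.ofReal_prod_of_nonneg fun _ _ => h _]
  rw [← ENNReal.ofReal_prod_of_nonneg fun _ _ => Finset.prod_nonneg fun _ _ => h _]
  simp only [cgDensity, mul_one, div_one, Finset.prod_mul_distrib, ← Real.exp_sum,
    Finset.sum_neg_distrib]

/-- Among sets of a given measure, a superlevel set of the density has the largest mass. -/
theorem setLIntegral_le_of_superlevel {α : Type*} [MeasurableSpace α] {μ : Measure α}
    {ρ : α → ENNReal} {E B : Set α} (hE : MeasurableSet E) (hB : MeasurableSet B)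
    (hEB : μ E = μ B) (hfin : μ B ≠ ⊤) {c : ENNReal} (hin : ∀ z ∈ B, c ≤ ρ z)
    (hout : ∀ z ∉ B, ρ z ≤ c) : ∫⁻ z in E, ρ z ∂μ ≤ ∫⁻ z in B, ρ z ∂μ := by
  have hdiff : μ (E \ B) = μ (B \ E) := by
    have h1 := measure_inter_add_sdiff (μ := μ) E hB
    have h2 := measure_inter_add_sdiff (μ := μ) B hE
    rw [Set.inter_comm, hEB, ← h2] at h1
    exact (ENNReal.add_right_inj (ne_top_of_le_ne_top hfin (measure_mono Set.inter_subset_left))).1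
      h1
  rw [← lintegral_inter_add_sdiff ρ E hB, ← lintegral_inter_add_sdiff ρ B hE, Set.inter_comm E B]
  gcongr 1
  calc ∫⁻ z in E \ B, ρ z ∂μ ≤ ∫⁻ _ in E \ B, c ∂μ :=
        setLIntegral_mono' (hE.diff hB) fun z hz => hout z hz.2
    _ = ∫⁻ _ in B \ E, c ∂μ := by simp [hdiff]
    _ ≤ ∫⁻ z in B \ E, ρ z ∂μ := setLIntegral_mono' (hB.diff hE) fun z hz => hin z hz.1

/-- Scaling the rows by factors of product one preserves volume. -/
theorem volume_preimage_scale {c : ι → ℝ} (hc : ∏ i, c i = 1) (s : Set (ι → κ → ℂ)) :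
    volume ((fun (z : ι → κ → ℂ) i l => c i • z i l) ⁻¹' s) = volume s := by
  let T : (ι → κ → ℂ) →ₗ[ℝ] (ι → κ → ℂ) :=
    LinearMap.pi fun i => (c i • (LinearMap.id : (κ → ℂ) →ₗ[ℝ] (κ → ℂ))).comp (LinearMap.proj i)
  have hdet : LinearMap.det T = 1 := by
    have := LinearMap.det_pi fun i => c i • (LinearMap.id : (κ → ℂ) →ₗ[ℝ] (κ → ℂ))
    rw [this]
    simp only [LinearMap.det_smul, LinearMap.det_id, mul_one, Finset.prod_pow, hc, one_pow]
  have hT : (fun (z : ι → κ → ℂ) i l => c i • z i l) = T := rfl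
  have : (volume : Measure (ι → κ → ℂ)).IsAddHaarMeasure :=
    Measure.pi.isAddHaarMeasure fun _ : ι => (volume : Measure (κ → ℂ))
  rw [hT, Measure.addHaar_preimage_linearMap volume (by rw [hdet]; exact one_ne_zero), hdet]
  simp

/-- An ellipsoid has at most the Gaussian mass of the ball of the same volume: for positive
weights `d i` of geometric mean `g`, the form `∑ d i |z i|²` is at least as likely to be small if
all its weights are replaced by `g`. -/
theorem iidGaussian_ellipsoid_le_ball {d : ι → ℝ} (hd : ∀ i, 0 < d i) {g : ℝ} (hg : 0 < g)
    (hgd : g ^ Fintype.card ι = ∏ i, d i) (x : ℝ) :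
    iidGaussian ι κ 1 {z | ∑ i, d i * ∑ l, ‖z i l‖ ^ 2 < x}
      ≤ iidGaussian ι κ 1 {z | g * ∑ i, ∑ l, ‖z i l‖ ^ 2 < x} := by
  have hE : MeasurableSet {z : ι → κ → ℂ | ∑ i, d i * ∑ l, ‖z i l‖ ^ 2 < x} :=
    measurableSet_lt (by fun_prop) measurable_const
  have hB : MeasurableSet {z : ι → κ → ℂ | g * ∑ i, ∑ l, ‖z i l‖ ^ 2 < x} :=
    measurableSet_lt (by fun_prop) measurable_const
  set C : ℝ := ∏ _i : ι, ∏ _l : κ, Real.pi⁻¹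
  have hC : 0 < C := Finset.prod_pos fun _ _ => Finset.prod_pos fun _ _ => inv_pos.2 Real.pi_pos
  have hden := iidGaussian_eq_withDensity (ι := ι) (κ := κ) one_pos
  simp_rw [prod_cgDensity_one] at hden
  -- The density of the Gaussian law on the boundary of the ball.
  set c : ENNReal := ENNReal.ofReal (C * Real.exp (-(x / g)))
  have hc : c ≠ 0 := by simpa [c] using (by positivity : 0 < C * Real.exp (-(x / g)))
  have hin : ∀ z ∈ {z : ι → κ → ℂ | g * ∑ i, ∑ l, ‖z i l‖ ^ 2 < x},
      c ≤ ENNReal.ofReal (C * Real.exp (-∑ i, ∑ l, ‖z i l‖ ^ 2)) := by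
    intro z hz
    refine ENNReal.ofReal_le_ofReal (mul_le_mul_of_nonneg_left (Real.exp_le_exp.2 ?_) hC.le)
    rw [neg_le_neg_iff, le_div_iff₀ hg, mul_comm]
    have hz' : g * ∑ i, ∑ l, ‖z i l‖ ^ 2 < x := hz
    exact hz'.le
  have hout : ∀ z ∉ {z : ι → κ → ℂ | g * ∑ i, ∑ l, ‖z i l‖ ^ 2 < x},
      ENNReal.ofReal (C * Real.exp (-∑ i, ∑ l, ‖z i l‖ ^ 2)) ≤ c := by
    intro z hz
    refine ENNReal.ofReal_le_ofReal (mul_le_mul_of_nonneg_left (Real.exp_le_exp.2 ?_) hC.le)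
    rw [neg_le_neg_iff, div_le_iff₀ hg, mul_comm]
    exact not_lt.1 hz
  have hvol : volume {z : ι → κ → ℂ | ∑ i, d i * ∑ l, ‖z i l‖ ^ 2 < x}
      = volume {z : ι → κ → ℂ | g * ∑ i, ∑ l, ‖z i l‖ ^ 2 < x} := by
    rw [← volume_preimage_scale (c := fun i => √(d i / g)) _
      {z : ι → κ → ℂ | g * ∑ i, ∑ l, ‖z i l‖ ^ 2 < x}]
    · congr 1
      ext z
      simp only [Set.preimage_ofPred_eq, Set.mem_ofPred_eq, norm_smul, mul_pow, ← Finset.mul_sum,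
        Real.norm_eq_abs, sq_abs, Real.sq_sqrt (div_nonneg (hd _).le hg.le)]
      rw [Finset.mul_sum]
      refine iff_of_eq (congrArg (· < x) (Finset.sum_congr rfl fun i _ => ?_))
      field_simp
    · rw [← Real.sqrt_prod _ fun i _ => div_nonneg (hd i).le hg.le, Finset.prod_div_distrib,
        ← hgd]
      simp [div_self (pow_pos hg _).ne']
  have hfin : volume {z : ι → κ → ℂ | g * ∑ i, ∑ l, ‖z i l‖ ^ 2 < x} ≠ ⊤ := by
    -- The density is at least `c` on the ball, which has a finite Gaussian mass.
    intro htop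
    have h1 : c * volume {z : ι → κ → ℂ | g * ∑ i, ∑ l, ‖z i l‖ ^ 2 < x}
        ≤ iidGaussian ι κ 1 {z | g * ∑ i, ∑ l, ‖z i l‖ ^ 2 < x} := by
      rw [hden, withDensity_apply _ hB, ← setLIntegral_const]
      exact setLIntegral_mono' hB hin
    rw [htop, ENNReal.mul_top hc] at h1
    exact (measure_ne_top (iidGaussian ι κ 1) _) (top_le_iff.1 h1)
  rw [hden, withDensity_apply _ hE, withDensity_apply _ hB]
  exact setLIntegral_le_of_superlevel hE hB hvol hfin hin hout

theorem iidGaussian_normSq_le [Nonempty ι] [Nonempty κ] (x : ℝ) :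
    iidGaussian ι κ 1 {z | ∑ i, ∑ l, ‖z i l‖ ^ 2 ≤ x}
      = ENNReal.ofReal (regGamma (Fintype.card ι * Fintype.card κ) x) := by
  have hm : Measurable fun z : ι → κ → ℂ => ∑ i, ∑ l, ‖z i l‖ ^ 2 := by fun_prop
  have hpos : (0 : ℝ) < (Fintype.card ι * Fintype.card κ : ℕ) := by
    exact_mod_cast Nat.mul_pos Fintype.card_pos Fintype.card_pos
  have hp := isProbabilityMeasure_gammaMeasure hpos (inv_pos.2 one_pos)
  have h := regGamma_eq_measureReal hpos one_pos x
  rw [div_one] at h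
  rw [← Nat.cast_mul, ← h, ofReal_measureReal, ← map_normSq_iidGaussian one_pos,
    Measure.map_apply hm measurableSet_Iic]
  rfl

theorem iidGaussian_lt_normSq [Nonempty ι] [Nonempty κ] (x : ℝ) :
    iidGaussian ι κ 1 {z | x < ∑ i, ∑ l, ‖z i l‖ ^ 2}
      = ENNReal.ofReal (1 - regGamma (Fintype.card ι * Fintype.card κ) x) := by
  have hm : MeasurableSet {z : ι → κ → ℂ | ∑ i, ∑ l, ‖z i l‖ ^ 2 ≤ x} :=
    measurableSet_le (by fun_prop) measurable_const
  have hpos : (0 : ℝ) < Fintype.card ι * Fintype.card κ := by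
    exact_mod_cast Nat.mul_pos Fintype.card_pos Fintype.card_pos
  have h : {z : ι → κ → ℂ | x < ∑ i, ∑ l, ‖z i l‖ ^ 2}
      = {z : ι → κ → ℂ | ∑ i, ∑ l, ‖z i l‖ ^ 2 ≤ x}ᶜ := by ext z; simp
  rw [h, prob_compl_eq_one_sub hm, iidGaussian_normSq_le,
    ENNReal.ofReal_sub _ (regGamma_nonneg hpos x), ENNReal.ofReal_one]

theorem pi_complexGaussian_lt_normSq [Nonempty ι] {v : ℝ} (hv : 0 < v) (x : ℝ) :
    (Measure.pi fun _ : ι => complexGaussian v) {z | x < ∑ i, ‖z i‖ ^ 2}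
      = ENNReal.ofReal (1 - regGamma (Fintype.card ι) (x / v)) := by
  have hm : Measurable fun z : ι → ℂ => ∑ i, ‖z i‖ ^ 2 := by fun_prop
  have hpos : (0 : ℝ) < Fintype.card ι := by exact_mod_cast Fintype.card_pos
  have hp := isProbabilityMeasure_gammaMeasure hpos (inv_pos.2 hv)
  have h : {z : ι → ℂ | x < ∑ i, ‖z i‖ ^ 2} = (fun z => ∑ i, ‖z i‖ ^ 2) ⁻¹' (Set.Iic x)ᶜ := by
    ext z; simp
  rw [h, ← Measure.map_apply hm measurableSet_Iic.compl, map_normSq_pi hv,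
    prob_compl_eq_one_sub measurableSet_Iic, ← regGamma_eq_measureReal hpos hv,
    ENNReal.ofReal_sub _ measureReal_nonneg, ofReal_measureReal, ENNReal.ofReal_one]

/-- Small values of a positive semidefinite diagonal form in a Gaussian matrix; only the non-zero
weights `d i` count, and `g` is their geometric mean. -/
theorem iidGaussian_ellipsoid_le_regGamma [Nonempty κ] {d : ι → ℝ} (hd : ∀ i, 0 ≤ d i)
    {m : ℕ} (hm0 : 0 < m) (hm : (Finset.univ.filter fun i => d i ≠ 0).card = m) {g : ℝ}
    (hg : 0 < g) (hgd : g ^ m = ∏ i ∈ Finset.univ.filter (fun i => d i ≠ 0), d i) (x : ℝ) :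
    iidGaussian ι κ 1 {z | ∑ i, d i * ∑ l, ‖z i l‖ ^ 2 < x}
      ≤ ENNReal.ofReal (regGamma (m * Fintype.card κ) (x / g)) := by
  classical
  set I := Finset.univ.filter fun i => d i ≠ 0 with hI
  have hcard : Fintype.card I = m := by rw [Fintype.card_coe, hm]
  have : Nonempty I := Fintype.card_pos_iff.1 (hcard ▸ hm0)
  have hmap := map_comp_pi (Measure.pi fun _ : κ => complexGaussian 1)
    (Subtype.val_injective (p := fun i => i ∈ I))
  have hE : MeasurableSet {z : I → κ → ℂ | ∑ i : I, d i * ∑ l, ‖z i l‖ ^ 2 < x} :=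
    measurableSet_lt (by fun_prop) measurable_const
  have hproj : Measurable fun (z : ι → κ → ℂ) (i : I) => z i := by fun_prop
  have h1 : iidGaussian ι κ 1 {z | ∑ i, d i * ∑ l, ‖z i l‖ ^ 2 < x}
      = iidGaussian I κ 1 {z | ∑ i : I, d i * ∑ l, ‖z i l‖ ^ 2 < x} := by
    rw [iidGaussian, iidGaussian, ← hmap, Measure.map_apply hproj hE]
    congr 1
    ext z
    simp only [Set.preimage_ofPred_eq, Set.mem_ofPred_eq]
    rw [Finset.sum_coe_sort I fun i => d i * ∑ l, ‖z i l‖ ^ 2, hI, Finset.sum_filter]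
    refine iff_of_eq (congrArg (· < x) (Finset.sum_congr rfl fun i _ => ?_))
    by_cases h : d i = 0 <;> simp [h]
  rw [h1]
  refine (iidGaussian_ellipsoid_le_ball (fun i : I => lt_of_le_of_ne (hd i)
    (Finset.mem_filter.1 i.2).2.symm) hg ?_ x).trans ?_
  · rw [hcard, hgd]
    exact (Finset.prod_coe_sort I d).symm
  · rw [← hcard, ← iidGaussian_normSq_le]
    refine measure_mono fun z hz => ?_
    have hz' : g * ∑ i, ∑ l, ‖z i l‖ ^ 2 < x := hz
    rw [Set.mem_ofPred_eq, le_div_iff₀ hg, mul_comm]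
    exact hz'.le

end Ellipsoid

/-! ### Almost sure rank of Gaussian matrices -/

section Rank

/-- If proper subspaces are null sets, then `k ≤ n` independent vectors are almost surely linearly
independent: the last one avoids the span of the others. -/
theorem ae_linearIndependent_pi {n : ℕ} (ν : Measure (Fin n → ℂ)) [IsProbabilityMeasure ν]
    (hν : ∀ W : Submodule ℂ (Fin n → ℂ), W ≠ ⊤ → ν W = 0) (k : ℕ) (hk : k ≤ n) :
    ∀ᵐ a ∂(Measure.pi fun _ : Fin k => ν), LinearIndependent ℂ a := by
  induction k with
  | zero => exact ae_of_all _ fun a => linearIndependent_empty_type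
  | succ k ih =>
    have hmp := (measurePreserving_piFinSuccAbove (fun _ : Fin (k + 1) => ν) 0).symm
    have hopen : MeasurableSet {a : Fin (k + 1) → Fin n → ℂ | LinearIndependent ℂ a} :=
      isOpen_setOfPred_linearIndependent.measurableSet
    rw [← hmp.map_eq, ae_map_iff hmp.measurable.aemeasurable hopen]
    have hcons : ∀ p : (Fin n → ℂ) × (Fin k → Fin n → ℂ),
        (MeasurableEquiv.piFinSuccAbove (fun _ : Fin (k + 1) => Fin n → ℂ) 0).symm p
          = (Fin.cons p.1 p.2 : Fin (k + 1) → Fin n → ℂ) := by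
      intro p
      simp [MeasurableEquiv.piFinSuccAbove, Fin.insertNthEquiv]
    have hms : MeasurableSet {p : (Fin n → ℂ) × (Fin k → Fin n → ℂ) | LinearIndependent ℂ
        ((MeasurableEquiv.piFinSuccAbove (fun _ : Fin (k + 1) => Fin n → ℂ) 0).symm p)} :=
      (MeasurableEquiv.measurable _) hopen
    refine (Measure.ae_prod_iff_ae_ae hms).2 ?_
    rw [Measure.ae_ae_comm hms]
    filter_upwards [ih (Nat.le_of_succ_le hk)] with v hv
    have hW : Submodule.span ℂ (Set.range v) ≠ ⊤ := by
      intro htop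
      have h1 := finrank_span_eq_card hv
      rw [htop, finrank_top, Module.finrank_fin_fun, Fintype.card_fin] at h1
      omega
    refine (measure_eq_zero_iff_ae_notMem.1 (hν _ hW)).mono fun x hx => ?_
    rw [hcons, linearIndependent_finCons]
    exact ⟨hv, hx⟩

theorem pi_complexGaussian_submodule {n : ℕ} {v : ℝ} (hv : 0 < v)
    (W : Submodule ℂ (Fin n → ℂ)) (hW : W ≠ ⊤) :
    (Measure.pi fun _ : Fin n => complexGaussian v) W = 0 := by
  have hm := (measurable_cgDensity v).ennreal_ofReal
  have h1 : SigmaFinite (volume.withDensity fun z => ENNReal.ofReal (cgDensity v z)) := by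
    rw [← complexGaussian_eq_withDensity hv]; infer_instance
  rw [complexGaussian_eq_withDensity hv, pi_withDensity volume hm]
  refine withDensity_absolutelyContinuous _ _ ?_
  refine Measure.addHaar_submodule (volume : Measure (Fin n → ℂ)) (W.restrictScalars ℝ) ?_
  simpa using hW

theorem gram_eq_mul_conjTranspose {n : ℕ} {ι : Type} (a : ι → Fin n → ℂ) (S : Finset ι) :
    gram a S = (Matrix.of fun (k : S) i => a k i)ᵀ * ((Matrix.of fun (k : S) i => a k i)ᵀ)ᴴ := by
  ext i j
  simp only [gram, Matrix.sum_apply, vecMulVec_apply, mul_apply, transpose_apply, of_apply,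
    conjTranspose_apply, Pi.star_apply]
  exact (Finset.sum_coe_sort S fun k => a k i * star (a k j)).symm

/-- Almost surely any `|S|` of the Gaussian columns have the largest possible rank. -/
theorem ae_rank_gram {n Ka : ℕ} {v : ℝ} (hv : 0 < v) (S : Finset (Fin Ka)) :
    ∀ᵐ a ∂(iidGaussian (Fin Ka) (Fin n) v), (gram a S).rank = min n S.card := by
  set m := min n S.card with hm
  have hmS : m ≤ S.card := min_le_right _ _
  let e : Fin m → Fin Ka := fun j => S.orderEmbOfFin rfl (Fin.castLE hmS j)
  have he : e.Injective := fun i j h => Fin.castLE_injective hmS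
    ((S.orderEmbOfFin rfl).injective h)
  have heS : ∀ j, e j ∈ S := fun j => S.orderEmbOfFin_mem rfl _
  have hLI := ae_linearIndependent_pi (Measure.pi fun _ : Fin n => complexGaussian v)
    (pi_complexGaussian_submodule hv) m (min_le_left _ _)
  rw [← map_comp_pi _ he] at hLI
  have h := ae_of_ae_map (measurable_pi_lambda _ fun k => measurable_pi_apply (e k)).aemeasurable hLI
  rw [iidGaussian]
  filter_upwards [h] with a ha
  rw [gram_eq_mul_conjTranspose, rank_self_mul_conjTranspose]
  apply le_antisymm
  · refine le_min ?_ ?_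
    · simpa using rank_le_card_height (Matrix.of fun (k : S) i => a k i)ᵀ
    · simpa using rank_le_card_width (Matrix.of fun (k : S) i => a k i)ᵀ
  · rw [rank_eq_finrank_span_cols]
    have h1 := finrank_span_eq_card ha
    rw [Fintype.card_fin] at h1
    rw [← h1]
    refine Submodule.finrank_mono (Submodule.span_mono ?_)
    rintro _ ⟨j, rfl⟩
    exact ⟨⟨e j, heS j⟩, rfl⟩

end Rank

/-! ### The non-zero eigenvalues of `F₁⁻¹ A_{S₁} A_{S₁}ᴴ` -/

section Eigen

variable {n Ka : ℕ}

theorem posSemidef_gram {ι : Type} (a : ι → Fin n → ℂ) (S : Finset ι) : (gram a S).PosSemidef :=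
  posSemidef_sum S fun _ _ => posSemidef_vecMulVec_self_star _

theorem posDef_matF1 (S : Finset (Fin Ka)) (a : Fin Ka → Fin n → ℂ) : (matF1 S a).PosDef :=
  PosDef.one.add_posSemidef (posSemidef_gram _ _)

theorem posDef_matF (a : Fin Ka → Fin n → ℂ) : (matF a).PosDef :=
  PosDef.one.add_posSemidef (posSemidef_gram _ _)

theorem posDef_matF' {t : ℕ} (S : Finset (Fin Ka)) (a : Fin Ka → Fin n → ℂ)
    (a' : Fin t → Fin n → ℂ) : (matF' S a a').PosDef :=
  (posDef_matF1 S a).add_posSemidef (posSemidef_gram _ _)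

theorem matF_eq_matF1_add (S : Finset (Fin Ka)) (a : Fin Ka → Fin n → ℂ) :
    matF a = matF1 S a + gram a S := by
  rw [matF, matF1, add_assoc, gram, gram, gram, Finset.sum_sdiff (Finset.subset_univ S)]

/-- If exactly `m` of the roots `d i` are non-zero, their product is up to sign the lowest non-zero
coefficient. -/
theorem coeff_prod_X_sub_C {ι : Type*} [Fintype ι] (d : ι → ℂ) {m : ℕ} [DecidablePred (d · ≠ 0)]
    (hm : (Finset.univ.filter fun i => d i ≠ 0).card = m) :
    (∏ i, (Polynomial.X - Polynomial.C (d i))).coeff (Fintype.card ι - m)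
      = ∏ i ∈ Finset.univ.filter (fun i => d i ≠ 0), -d i := by
  classical
  rw [← Finset.prod_filter_mul_prod_filter_not Finset.univ fun i => d i ≠ 0]
  have h0 : ∏ i ∈ Finset.univ.filter (fun i => ¬ d i ≠ 0), (Polynomial.X - Polynomial.C (d i))
      = Polynomial.X ^ (Fintype.card ι - m) := by
    rw [Finset.prod_congr rfl (g := fun _ => Polynomial.X), Finset.prod_const]
    · congr 1
      have := Finset.card_filter_add_card_filter_not (s := (Finset.univ : Finset ι))
        (fun i => d i ≠ 0)
      rw [Finset.card_univ] at this
      omega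
    · intro i hi
      simp only [ne_eq, not_not, Finset.mem_filter] at hi
      simp [hi.2]
  rw [h0, Polynomial.coeff_mul_X_pow', if_pos le_rfl, Nat.sub_self,
    Polynomial.coeff_zero_eq_eval_zero, Polynomial.eval_prod]
  simp

/-- Simultaneous diagonalisation of `F₁` and `A_{S₁} A_{S₁}ᴴ`. The weights `d` are the eigenvalues
of `F₁⁻¹ A_{S₁} A_{S₁}ᴴ`, and the product of the non-zero ones is a coefficient of the
characteristic polynomial. -/
theorem exists_diagonalization_gram (S : Finset (Fin Ka)) (a : Fin Ka → Fin n → ℂ) {m : ℕ}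
    (hrank : (gram a S).rank = m) :
    ∃ (R : Matrix (Fin n) (Fin n) ℂ) (d : Fin n → ℝ), IsUnit R ∧ matF1 S a = R * Rᴴ ∧
      gram a S = R * diagonal (fun i => (d i : ℂ)) * Rᴴ ∧ (∀ i, 0 ≤ d i) ∧
      (Finset.univ.filter fun i => d i ≠ 0).card = m ∧
      eigenFactor m S a
        = (∏ i ∈ Finset.univ.filter (fun i => d i ≠ 0), d i) ^ (-(1 / (m : ℝ))) ∧
      ‖((matF1 S a)⁻¹ * gram a S).charpoly.coeff (n - m)‖
        = ∏ i ∈ Finset.univ.filter (fun i => d i ≠ 0), d i := by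
  obtain ⟨R, d, hR, hF, hG⟩ := exists_simultaneous_diagonalization (posDef_matF1 S a)
    (posSemidef_gram a S).isHermitian
  have hRd := isUnit_det_of_isUnit hR
  have hRd' := isUnit_det_conjTranspose hR
  have hd : ∀ i, 0 ≤ d i := by
    have h1 : (R * diagonal (fun i => (d i : ℂ)) * star R).PosSemidef := by
      rw [star_eq_conjTranspose, ← hG]; exact posSemidef_gram a S
    rw [IsUnit.posSemidef_star_right_conjugate_iff hR, posSemidef_diagonal_iff] at h1
    intro i
    exact_mod_cast h1 i
  have hcard : (Finset.univ.filter fun i => d i ≠ 0).card = m := by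
    rw [← hrank, hG, rank_mul_eq_left_of_isUnit_det _ _ hRd',
      rank_mul_eq_right_of_isUnit_det _ _ hRd, rank_diagonal, Fintype.card_subtype]
    simp
  have hchar : ((matF1 S a)⁻¹ * gram a S).charpoly
      = ∏ i, (Polynomial.X - Polynomial.C (d i : ℂ)) := by
    have h1 : (matF1 S a)⁻¹ * gram a S = Rᴴ⁻¹ * (diagonal (fun i => (d i : ℂ)) * Rᴴ) := by
      rw [hF, hG, Matrix.mul_inv_rev, Matrix.mul_assoc, Matrix.mul_assoc R, ← Matrix.mul_assoc R⁻¹,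
        nonsing_inv_mul _ hRd, Matrix.one_mul]
    rw [h1, charpoly_mul_comm, Matrix.mul_assoc, mul_nonsing_inv _ hRd', Matrix.mul_one,
      charpoly_diagonal]
  refine ⟨R, d, hR, hF, hG, hd, hcard, ?_, ?_⟩
  · have hroots : (∏ i, (Polynomial.X - Polynomial.C (d i : ℂ))).roots
        = Finset.univ.val.map fun i => (d i : ℂ) := by
      rw [← Polynomial.roots_multiset_prod_X_sub_C (Finset.univ.val.map fun i => (d i : ℂ)),
        Multiset.map_map]
      rfl
    rw [eigenFactor, hchar, hroots, ← Real.finsetProd_rpow _ _ fun i _ => hd i,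
      Multiset.filter_map, Multiset.map_map]
    simp only [Function.comp_def, Complex.ofReal_re, ne_eq, Complex.ofReal_eq_zero]
    rfl
  · have h := coeff_prod_X_sub_C (fun i => (d i : ℂ)) (m := m) (by simpa using hcard)
    rw [Fintype.card_fin] at h
    rw [hchar, h, norm_prod]
    simp [abs_of_nonneg (hd _)]

end Eigen

/-! ### Continuity and measurability of the matrix functions -/

section Continuity

variable {α : Type*} [TopologicalSpace α] {n Ka t : ℕ}

theorem continuous_nonsing_inv {M : α → Matrix (Fin n) (Fin n) ℂ} (hM : Continuous M)
    (hdet : ∀ a, (M a).PosDef) : Continuous fun a => (M a)⁻¹ := by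
  simp only [inv_def, Ring.inverse_eq_inv']
  exact (hM.matrix_det.inv₀ fun a => (hdet a).det_pos.ne').smul hM.matrix_adjugate

theorem continuous_logDet {M : α → Matrix (Fin n) (Fin n) ℂ} (hM : Continuous M)
    (hdet : ∀ a, (M a).PosDef) : Continuous fun a => logDet (M a) :=
  (Complex.continuous_re.comp hM.matrix_det).log fun a =>
    ((Complex.lt_def.1 (hdet a).det_pos).1).ne'

theorem continuous_gram {ι : Type} (S : Finset ι) :
    Continuous fun a : ι → Fin n → ℂ => gram a S :=
  continuous_finsetSum _ fun k _ =>
    (continuous_apply k).matrix_vecMulVec (continuous_apply k).star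

theorem continuous_matF1 (S : Finset (Fin Ka)) :
    Continuous fun a : Fin Ka → Fin n → ℂ => matF1 S a :=
  continuous_const.add (continuous_gram _)

theorem continuous_matF : Continuous fun a : Fin Ka → Fin n → ℂ => matF a :=
  continuous_const.add (continuous_gram _)

theorem continuous_matF' (S : Finset (Fin Ka)) :
    Continuous fun p : (Fin Ka → Fin n → ℂ) × (Fin t → Fin n → ℂ) => matF' S p.1 p.2 :=
  ((continuous_matF1 S).comp continuous_fst).add ((continuous_gram _).comp continuous_snd)

theorem continuous_charpoly_coeff (i : ℕ) :
    Continuous fun M : Matrix (Fin n) (Fin n) ℂ => M.charpoly.coeff i := by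
  have h : ∀ M : Matrix (Fin n) (Fin n) ℂ, M.charpoly.coeff i
      = MvPolynomial.eval (fun p : Fin n × Fin n => M p.1 p.2)
        ((Matrix.charpoly.univ ℂ (Fin n)).coeff i) := by
    intro M
    exact (Matrix.charpoly.univ_coeff_eval₂Hom (Fin n) (RingHom.id ℂ)
      (fun p : Fin n × Fin n => M p.1 p.2) i).symm
  simp_rw [h]
  exact (MvPolynomial.continuous_eval _).comp
    (continuous_pi fun p => (continuous_apply p.2).comp (continuous_apply p.1))

theorem posDef_of_sphere {M : Matrix (Fin n) (Fin n) ℂ} (hM : M.IsHermitian)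
    (h : ∀ x ∈ Metric.sphere (0 : Fin n → ℂ) 1, 0 < (star x ⬝ᵥ M *ᵥ x).re) : M.PosDef := by
  refine PosDef.of_dotProduct_mulVec_pos hM fun x hx => ?_
  have hx0 : ‖x‖ ≠ 0 := norm_ne_zero_iff.2 hx
  have h1 := h ((‖x‖⁻¹ : ℂ) • x) (by simp [norm_smul, hx0])
  have h2 : star ((‖x‖⁻¹ : ℂ) • x) ⬝ᵥ M *ᵥ ((‖x‖⁻¹ : ℂ) • x)
      = ((‖x‖⁻¹ ^ 2 : ℝ) : ℂ) * (star x ⬝ᵥ M *ᵥ x) := by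
    rw [star_smul, mulVec_smul, smul_dotProduct, dotProduct_smul]
    simp only [smul_eq_mul, star_inv₀, RCLike.star_def, Complex.conj_ofReal]
    push_cast
    ring
  rw [h2, Complex.re_ofReal_mul] at h1
  refine Complex.lt_def.2 ⟨?_, ?_⟩
  · exact (mul_pos_iff_of_pos_left (pow_pos (inv_pos.2 (norm_pos_iff.2 hx)) 2)).1 h1
  · exact (hM.im_star_dotProduct_mulVec_self x).symm

/-- Positive definiteness is an open condition on Hermitian matrices. -/
theorem isOpen_posDef {X : α → Matrix (Fin n) (Fin n) ℂ} (hX : Continuous X)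
    (hherm : ∀ a, (X a).IsHermitian) : IsOpen {a | (X a).PosDef} := by
  refine isOpen_iff_eventually.2 fun a₀ ha₀ => ?_
  have hcont : Continuous fun p : α × (Fin n → ℂ) => (star p.2 ⬝ᵥ X p.1 *ᵥ p.2).re :=
    Complex.continuous_re.comp (continuous_snd.star.dotProduct
      ((hX.comp continuous_fst).matrix_mulVec continuous_snd))
  have key := (isCompact_sphere (0 : Fin n → ℂ) 1).eventually_forall_of_forall_eventually
    (x₀ := a₀) (P := fun a x => 0 < (star x ⬝ᵥ X a *ᵥ x).re) fun x hx => by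
      refine (hcont.tendsto (a₀, x)).eventually_const_lt ?_
      have hx0 : x ≠ 0 := by
        rintro rfl
        simp at hx
      exact PosDef.re_dotProduct_pos ha₀ hx0
  exact key.mono fun a ha => posDef_of_sphere (hherm a) ha

end Continuity

/-! ### The optimisation over `(u, r)` -/

section Chernoff

variable {n Ka t : ℕ}

/-- The Hermitian matrix `(1 - u + r) F⁻¹ + u F'⁻¹ - r ω F₁⁻¹`, whose product with `F` is `B`. -/
noncomputable def tiltedPrecision (S : Finset (Fin Ka)) (ω u r : ℝ) (a : Fin Ka → Fin n → ℂ)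
    (a' : Fin t → Fin n → ℂ) : Matrix (Fin n) (Fin n) ℂ :=
  ((1 - u + r : ℝ) : ℂ) • (matF a)⁻¹ + (u : ℂ) • (matF' S a a')⁻¹
    - ((r * ω : ℝ) : ℂ) • (matF1 S a)⁻¹

theorem isHermitian_ofReal_smul {M : Matrix (Fin n) (Fin n) ℂ} (hM : M.IsHermitian) (c : ℝ) :
    ((c : ℂ) • M).IsHermitian := by
  simp [IsHermitian, conjTranspose_smul, hM.eq]

theorem isHermitian_tiltedPrecision (S : Finset (Fin Ka)) (ω u r : ℝ) (a : Fin Ka → Fin n → ℂ)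
    (a' : Fin t → Fin n → ℂ) : (tiltedPrecision S ω u r a a').IsHermitian :=
  ((isHermitian_ofReal_smul (posDef_matF a).isHermitian.inv _).add
    (isHermitian_ofReal_smul (posDef_matF' S a a').isHermitian.inv _)).sub
    (isHermitian_ofReal_smul (posDef_matF1 S a).isHermitian.inv _)

theorem matB_eq_mul (S : Finset (Fin Ka)) (ω u r : ℝ) (a : Fin Ka → Fin n → ℂ)
    (a' : Fin t → Fin n → ℂ) : matB S ω u r a a' = tiltedPrecision S ω u r a a' * matF a := by
  rw [matB, tiltedPrecision, Matrix.sub_mul, Matrix.add_mul, Matrix.smul_mul, Matrix.smul_mul,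
    Matrix.smul_mul, nonsing_inv_mul _ (isUnit_det_of_isUnit (posDef_matF a).isUnit)]

theorem continuous_tiltedPrecision (S : Finset (Fin Ka)) (ω u r : ℝ) :
    Continuous fun p : (Fin Ka → Fin n → ℂ) × (Fin t → Fin n → ℂ) =>
      tiltedPrecision S ω u r p.1 p.2 := by
  have h1 : Continuous fun p : (Fin Ka → Fin n → ℂ) × (Fin t → Fin n → ℂ) => (matF p.1)⁻¹ :=
    continuous_nonsing_inv (continuous_matF.comp continuous_fst) fun p => posDef_matF p.1
  have h2 : Continuous fun p : (Fin Ka → Fin n → ℂ) × (Fin t → Fin n → ℂ) =>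
      (matF' S p.1 p.2)⁻¹ :=
    continuous_nonsing_inv (continuous_matF' S) fun p => posDef_matF' S p.1 p.2
  have h3 : Continuous fun p : (Fin Ka → Fin n → ℂ) × (Fin t → Fin n → ℂ) => (matF1 S p.1)⁻¹ :=
    continuous_nonsing_inv ((continuous_matF1 S).comp continuous_fst) fun p => posDef_matF1 S p.1
  unfold tiltedPrecision
  fun_prop

/-- `F` and the tilted precision matrix are diagonalised together; the diagonal `d` consists of the
eigenvalues of `B`. -/
theorem exists_diagonalization_matB (S : Finset (Fin Ka)) (ω u r : ℝ) (a : Fin Ka → Fin n → ℂ)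
    (a' : Fin t → Fin n → ℂ) :
    ∃ (R : Matrix (Fin n) (Fin n) ℂ) (d : Fin n → ℝ), IsUnit R ∧ matF a = R * Rᴴ ∧
      Rᴴ * tiltedPrecision S ω u r a a' * R = diagonal (fun i => (d i : ℂ)) ∧
      (matB S ω u r a a').det = ((∏ i, d i : ℝ) : ℂ) ∧
      ((u, r) ∈ {p : ℝ × ℝ | ∀ z ∈ spectrum ℂ (matB S ω p.1 p.2 a a'), 0 < z.re}
        ↔ ∀ i, 0 < d i) ∧
      ((tiltedPrecision S ω u r a a').PosDef ↔ ∀ i, 0 < d i) := by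
  set X := tiltedPrecision S ω u r a a' with hX
  have hXh : X.IsHermitian := isHermitian_tiltedPrecision S ω u r a a'
  have hF := posDef_matF a
  have hFu := isUnit_det_of_isUnit hF.isUnit
  obtain ⟨R, d, hR, hRF, hG⟩ := exists_simultaneous_diagonalization hF
    (G := matF a * X * matF a) (by
      simp only [IsHermitian, conjTranspose_mul, hXh.eq, hF.isHermitian.eq, Matrix.mul_assoc])
  have hRd := isUnit_det_of_isUnit hR
  have hRd' := isUnit_det_conjTranspose hR
  have hdiag : Rᴴ * X * R = diagonal (fun i => (d i : ℂ)) := by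
    have h1 : R * (Rᴴ * X * R) * Rᴴ = R * diagonal (fun i => (d i : ℂ)) * Rᴴ := by
      rw [← hG, hRF]; simp only [Matrix.mul_assoc]
    have h2 := congrArg (fun T => R⁻¹ * T * Rᴴ⁻¹) h1
    simp only [Matrix.mul_assoc] at h2 ⊢
    rw [← Matrix.mul_assoc R⁻¹, nonsing_inv_mul _ hRd, Matrix.one_mul, mul_nonsing_inv _ hRd',
      ← Matrix.mul_assoc R⁻¹, nonsing_inv_mul _ hRd, Matrix.one_mul] at h2
    simpa using h2
  have hchar : (matB S ω u r a a').charpoly = (diagonal (fun i => (d i : ℂ))).charpoly := by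
    rw [matB_eq_mul, hRF, charpoly_mul_self_conjTranspose, ← hX, hdiag]
  refine ⟨R, d, hR, hRF, hdiag, ?_, ?_, ?_⟩
  · rw [det_eq_sign_charpoly_coeff, hchar, ← det_eq_sign_charpoly_coeff, det_diagonal]
    push_cast
    rfl
  · have hspec : spectrum ℂ (matB S ω u r a a') = Set.range fun i => (d i : ℂ) := by
      ext z
      rw [mem_spectrum_iff_isRoot_charpoly, hchar, ← mem_spectrum_iff_isRoot_charpoly,
        spectrum_diagonal]
    simp [hspec]
  · rw [← IsUnit.posDef_star_left_conjugate_iff hR, star_eq_conjTranspose, hdiag,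
      posDef_diagonal_iff]
    simp

/-- The condition `λ_min(B) > 0` means that the tilted precision matrix is positive definite. -/
theorem mem_admissible_iff (S : Finset (Fin Ka)) (ω : ℝ) (a : Fin Ka → Fin n → ℂ)
    (a' : Fin t → Fin n → ℂ) (p : ℝ × ℝ) :
    p ∈ admissible S ω a a' ↔ 0 ≤ p.1 ∧ 0 ≤ p.2 ∧ (tiltedPrecision S ω p.1 p.2 a a').PosDef := by
  obtain ⟨R, d, -, -, -, -, h1, h2⟩ := exists_diagonalization_matB S ω p.1 p.2 a a'
  rw [h2, ← h1]
  rfl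

theorem zero_mem_admissible (S : Finset (Fin Ka)) (ω : ℝ) (a : Fin Ka → Fin n → ℂ)
    (a' : Fin t → Fin n → ℂ) : ((0, 0) : ℝ × ℝ) ∈ admissible S ω a a' := by
  rw [mem_admissible_iff]
  refine ⟨le_rfl, le_rfl, ?_⟩
  simpa [tiltedPrecision] using (posDef_matF a).inv

/-- The function of `(u, r)` that is minimised in `q1Integrand`. -/
noncomputable def chernoffValue (L : ℕ) (S : Finset (Fin Ka)) (ω ν : ℝ) (p : ℝ × ℝ)
    (a : Fin Ka → Fin n → ℂ) (a' : Fin t → Fin n → ℂ) : ℝ :=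
  Real.exp (L * p.2 * n * ν) *
    Real.exp (L * ((p.1 - p.2) * logDet (matF a) - p.1 * logDet (matF' S a a')
      + p.2 * ω * logDet (matF1 S a) - logDet (matB S ω p.1 p.2 a a')))

theorem q1Integrand_eq (L : ℕ) (S : Finset (Fin Ka)) (ω ν : ℝ) (a : Fin Ka → Fin n → ℂ)
    (a' : Fin t → Fin n → ℂ) :
    q1Integrand L S ω ν a a' = ⨅ p : admissible S ω a a', chernoffValue L S ω ν p a a' := rfl

theorem bddBelow_chernoffValue (L : ℕ) (S : Finset (Fin Ka)) (ω ν : ℝ) (a : Fin Ka → Fin n → ℂ)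
    (a' : Fin t → Fin n → ℂ) :
    BddBelow (Set.range fun p : admissible S ω a a' => chernoffValue L S ω ν p a a') :=
  ⟨0, by rintro _ ⟨p, rfl⟩; unfold chernoffValue; positivity⟩

theorem q1Integrand_nonneg (L : ℕ) (S : Finset (Fin Ka)) (ω ν : ℝ) (a : Fin Ka → Fin n → ℂ)
    (a' : Fin t → Fin n → ℂ) : 0 ≤ q1Integrand L S ω ν a a' :=
  Real.iInf_nonneg fun p => by positivity

theorem q1Integrand_le_one (L : ℕ) (S : Finset (Fin Ka)) (ω ν : ℝ) (a : Fin Ka → Fin n → ℂ)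
    (a' : Fin t → Fin n → ℂ) : q1Integrand L S ω ν a a' ≤ 1 := by
  refine (ciInf_le (bddBelow_chernoffValue L S ω ν a a') ⟨_, zero_mem_admissible S ω a a'⟩).trans
    (le_of_eq ?_)
  simp [chernoffValue, matB, logDet]

/-- The minimum over `(u, r)` is upper semicontinuous in the codewords, hence measurable: for each
`(u, r)`, admissibility is an open condition. -/
theorem measurable_q1Integrand (L : ℕ) (S : Finset (Fin Ka)) (ω ν : ℝ) :
    Measurable fun p : (Fin Ka → Fin n → ℂ) × (Fin t → Fin n → ℂ) =>
      q1Integrand L S ω ν p.1 p.2 := by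
  refine measurable_of_Iio fun c => ?_
  have hset : (fun p : (Fin Ka → Fin n → ℂ) × (Fin t → Fin n → ℂ) =>
      q1Integrand L S ω ν p.1 p.2) ⁻¹' Set.Iio c
      = ⋃ w : ℝ × ℝ, {p | w ∈ admissible S ω p.1 p.2 ∧ chernoffValue L S ω ν w p.1 p.2 < c} := by
    ext p
    have : Nonempty (admissible S ω p.1 p.2) := ⟨⟨_, zero_mem_admissible S ω p.1 p.2⟩⟩
    simp only [Set.mem_preimage, Set.mem_Iio, q1Integrand_eq,
      ciInf_lt_iff (bddBelow_chernoffValue L S ω ν p.1 p.2), Set.mem_iUnion, Set.mem_ofPred_eq,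
      Subtype.exists, exists_prop]
  rw [hset]
  refine (isOpen_iUnion fun w => ?_).measurableSet
  by_cases hw : 0 ≤ w.1 ∧ 0 ≤ w.2
  · have hO := isOpen_posDef (continuous_tiltedPrecision (n := n) (t := t) S ω w.1 w.2)
      fun p => isHermitian_tiltedPrecision S ω w.1 w.2 p.1 p.2
    have hcont : ContinuousOn (fun p : (Fin Ka → Fin n → ℂ) × (Fin t → Fin n → ℂ) =>
        chernoffValue L S ω ν w p.1 p.2)
        {p | (tiltedPrecision S ω w.1 w.2 p.1 p.2).PosDef} := by
      have c1 : Continuous fun p : (Fin Ka → Fin n → ℂ) × (Fin t → Fin n → ℂ) =>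
          logDet (matF p.1) :=
        continuous_logDet (continuous_matF.comp continuous_fst) fun p => posDef_matF p.1
      have c2 : Continuous fun p : (Fin Ka → Fin n → ℂ) × (Fin t → Fin n → ℂ) =>
          logDet (matF' S p.1 p.2) :=
        continuous_logDet (continuous_matF' S) fun p => posDef_matF' S p.1 p.2
      have c3 : Continuous fun p : (Fin Ka → Fin n → ℂ) × (Fin t → Fin n → ℂ) =>
          logDet (matF1 S p.1) :=
        continuous_logDet ((continuous_matF1 S).comp continuous_fst) fun p => posDef_matF1 S p.1
      have c4 : ContinuousOn (fun p : (Fin Ka → Fin n → ℂ) × (Fin t → Fin n → ℂ) =>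
          logDet (matB S ω w.1 w.2 p.1 p.2))
          {p | (tiltedPrecision S ω w.1 w.2 p.1 p.2).PosDef} := by
        have hd : Continuous fun p : (Fin Ka → Fin n → ℂ) × (Fin t → Fin n → ℂ) =>
            (matB S ω w.1 w.2 p.1 p.2).det.re := by
          simp_rw [matB_eq_mul]
          exact Complex.continuous_re.comp ((continuous_tiltedPrecision S ω w.1 w.2).matrix_mul
            (continuous_matF.comp continuous_fst)).matrix_det
        refine hd.continuousOn.log fun p hp => ?_
        obtain ⟨R, d, -, -, -, h0, -, h2⟩ := exists_diagonalization_matB S ω w.1 w.2 p.1 p.2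
        rw [h0, Complex.ofReal_re]
        exact (Finset.prod_pos fun i _ => h2.1 hp i).ne'
      unfold chernoffValue
      fun_prop
    have := hcont.isOpen_inter_preimage hO (isOpen_Iio (a := c))
    convert this using 1
    ext p
    simp [mem_admissible_iff, hw]
  · convert isOpen_empty using 1
    ext p
    simp only [mem_admissible_iff, Set.mem_ofPred_eq, Set.mem_empty_iff_false, iff_false]
    tauto

end Chernoff

/-! ### Measurability of the integrand of `q2` -/

section Q2

variable {n Ka : ℕ}

theorem continuous_q2Numerator (S : Finset (Fin Ka)) (ω ν δ : ℝ) :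
    Continuous fun a : Fin Ka → Fin n → ℂ => q2Numerator S ω ν δ a := by
  have c1 : Continuous fun a : Fin Ka → Fin n → ℂ => logDet (matF a) :=
    continuous_logDet continuous_matF posDef_matF
  have c3 : Continuous fun a : Fin Ka → Fin n → ℂ => logDet (matF1 S a) :=
    continuous_logDet (continuous_matF1 S) (posDef_matF1 S)
  unfold q2Numerator
  fun_prop

/-- Almost surely the product of the non-zero eigenvalues in `eigenFactor` is the absolute value of
a coefficient of the characteristic polynomial, which is continuous in the codewords. -/
theorem aemeasurable_q2Integrand {v : ℝ} (hv : 0 < v) {L m : ℕ} (hL : 0 < L) (hm : 0 < m)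
    (S : Finset (Fin Ka)) (hS : min n S.card = m) (ω ν δ : ℝ) :
    AEMeasurable (fun a : Fin Ka → Fin n → ℂ => q2Integrand L m S ω ν δ a)
      (iidGaussian (Fin Ka) (Fin n) v) := by
  have hcN := continuous_q2Numerator (n := n) S ω ν δ
  by_cases hω : ω = 0
  · simp only [q2Integrand, if_pos hω]
    exact (Measurable.ite (measurableSet_lt measurable_const hcN.measurable) measurable_const
      measurable_const).aemeasurable
  · have hcoef : Continuous fun a : Fin Ka → Fin n → ℂ =>
        ((matF1 S a)⁻¹ * gram a S).charpoly.coeff (n - m) :=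
      (continuous_charpoly_coeff _).comp ((continuous_nonsing_inv (continuous_matF1 S)
        (posDef_matF1 S)).matrix_mul (continuous_gram S))
    have hpos : (0 : ℝ) < L * m := by exact_mod_cast Nat.mul_pos hL hm
    refine ⟨fun a => regGamma (L * m) (L *
      ‖((matF1 S a)⁻¹ * gram a S).charpoly.coeff (n - m)‖ ^ (-(1 / (m : ℝ))) *
        (q2Numerator S ω ν δ a / ω)), ?_, ?_⟩
    · refine (monotone_regGamma hpos).measurable.comp ?_
      exact (((hcoef.norm.measurable.pow_const _).const_mul _)).mul (hcN.measurable.div_const _)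
    · filter_upwards [ae_rank_gram (n := n) hv S] with a ha
      obtain ⟨R, d, -, -, -, -, -, he, hc⟩ := exists_diagonalization_gram S a (ha.trans hS)
      rw [q2Integrand, if_neg hω, he, hc]

theorem q2Integrand_mem_Icc {L m : ℕ} (hL : 0 < L) (hm : 0 < m) (S : Finset (Fin Ka))
    (ω ν δ : ℝ) (a : Fin Ka → Fin n → ℂ) : q2Integrand L m S ω ν δ a ∈ Set.Icc 0 1 := by
  have hpos : (0 : ℝ) < L * m := by exact_mod_cast Nat.mul_pos hL hm
  unfold q2Integrand
  split_ifs
  · simp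
  · simp
  · exact ⟨regGamma_nonneg hpos _, regGamma_le_one hpos _⟩

end Q2

/-! ### Error bounds for a fixed codebook -/

section Conditional

variable {n Ka t L : ℕ} {τ : Type} [Fintype τ]

/-- The decoding metric `L ln |G| + tr (G⁻¹ Y Yᴴ)` of a covariance matrix `G`. -/
noncomputable def covMetric (G : Matrix (Fin n) (Fin n) ℂ) (y : Received n L) : ℝ :=
  L * logDet G + (G⁻¹ * ((Matrix.of y) * (Matrix.of y)ᴴ)).trace.re

theorem continuous_covMetric (G : Matrix (Fin n) (Fin n) ℂ) :
    Continuous fun y : Received n L => covMetric G y := by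
  have h1 : Continuous fun y : Received n L => (Matrix.of y : Matrix (Fin n) (Fin L) ℂ) :=
    continuous_id
  have h2 : Continuous fun y : Received n L => (G⁻¹ * ((Matrix.of y) * (Matrix.of y)ᴴ)).trace.re :=
    Complex.continuous_re.comp
      (continuous_const.matrix_mul (h1.matrix_mul h1.matrix_conjTranspose)).matrix_trace
  unfold covMetric
  fun_prop

/-- The received signal over the channel with signature matrix `C`. -/
noncomputable def linearChannel (C : Matrix (Fin n) τ ℂ)
    (p : (τ → Fin L → ℂ) × (Fin n → Fin L → ℂ)) : Received n L :=
  fun i l => (C * Matrix.of p.1) i l + p.2 i l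

theorem measurable_linearChannel (C : Matrix (Fin n) τ ℂ) :
    Measurable (linearChannel (L := L) C) :=
  ((measurable_matrix_mul_of C).comp measurable_fst).add measurable_snd

theorem measure_linearChannel_preimage (C : Matrix (Fin n) τ ℂ) {R : Matrix (Fin n) (Fin n) ℂ}
    (hR : R * Rᴴ = 1 + C * Cᴴ) {s : Set (Received n L)} (hs : MeasurableSet s) :
    ((iidGaussian τ (Fin L) 1).prod (iidGaussian (Fin n) (Fin L) 1)) (linearChannel C ⁻¹' s)
      = iidGaussian (Fin n) (Fin L) 1 {z | (fun i l => (R * Matrix.of z) i l) ∈ s} := by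
  rw [← Measure.map_apply (measurable_linearChannel C) hs]
  have := map_add_eq_map_mul (κ := Fin L) C R hR
  unfold linearChannel
  rw [this, Measure.map_apply (measurable_matrix_mul_of R) hs]
  rfl

theorem of_mul_of (R : Matrix (Fin n) (Fin n) ℂ) (z : Fin n → Fin L → ℂ) :
    (Matrix.of fun i l => (R * Matrix.of z) i l) = R * Matrix.of z := rfl

theorem conjTranspose_mul_inv_mul_self {R F : Matrix (Fin n) (Fin n) ℂ} (hR : IsUnit R)
    (hF : F = R * Rᴴ) : Rᴴ * F⁻¹ * R = 1 := by
  rw [hF, Matrix.mul_inv_rev, ← Matrix.mul_assoc, mul_nonsing_inv _ (isUnit_det_conjTranspose hR),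
    Matrix.one_mul, nonsing_inv_mul _ (isUnit_det_of_isUnit hR)]

/-- Chernoff's bound for the event that the metric of a wrong hypothesis `F'` is at most that of
the true covariance `F`, within the region where the latter is not much larger than that of `F₁`. -/
theorem measure_confusion_le_chernoffValue (C : Matrix (Fin n) τ ℂ) (S : Finset (Fin Ka))
    (a : Fin Ka → Fin n → ℂ) (a' : Fin t → Fin n → ℂ) (hC : matF a = 1 + C * Cᴴ) (ω ν : ℝ)
    {p : ℝ × ℝ} (hp : p ∈ admissible S ω a a') :
    ((iidGaussian τ (Fin L) 1).prod (iidGaussian (Fin n) (Fin L) 1)) (linearChannel C ⁻¹'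
      {y | covMetric (matF' S a a') y ≤ covMetric (matF a) y ∧
        covMetric (matF a) y ≤ ω * covMetric (matF1 S a) y + n * L * ν})
      ≤ ENNReal.ofReal (chernoffValue L S ω ν p a a') := by
  obtain ⟨u, r⟩ := p
  have hadm := (mem_admissible_iff S ω a a' (u, r)).1 hp
  obtain ⟨hu, hr, hX⟩ := hadm
  obtain ⟨R, d, hR, hF, hdiag, hdet, -, hpos⟩ := exists_diagonalization_matB S ω u r a a'
  replace hpos := hpos.1 hX
  have hs : MeasurableSet {y : Received n L | covMetric (matF' S a a') y ≤ covMetric (matF a) y ∧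
        covMetric (matF a) y ≤ ω * covMetric (matF1 S a) y + n * L * ν} :=
    (measurableSet_le (continuous_covMetric _).measurable (continuous_covMetric _).measurable).inter
      (measurableSet_le (continuous_covMetric _).measurable
        (((continuous_covMetric _).measurable.const_mul _).add_const _))
  rw [measure_linearChannel_preimage C (hF.symm.trans hC) hs]
  set c₀ : ℝ := L * r * n * ν + L * ((u - r) * logDet (matF a) - u * logDet (matF' S a a')
      + r * ω * logDet (matF1 S a)) with hc₀
  -- In the coordinates `y = R z` the exponent of Chernoff's bound is a constant minus a quadratic
  -- form. The form of the tilted precision matrix is diagonal with weights `d`; the `1` that is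
  -- subtracted from the weights is the form of `F⁻¹`, the exponent of the Gaussian density.
  have hexp : ∀ z : Fin n → Fin L → ℂ,
      u * (covMetric (matF a) (fun i l => (R * Matrix.of z) i l)
          - covMetric (matF' S a a') (fun i l => (R * Matrix.of z) i l))
        + r * (ω * covMetric (matF1 S a) (fun i l => (R * Matrix.of z) i l) + n * L * ν
          - covMetric (matF a) (fun i l => (R * Matrix.of z) i l))
        = c₀ + -∑ i, (d i - 1) * ∑ l, ‖z i l‖ ^ 2 := by
    intro z
    have e1 : ∑ i, (d i - 1) * ∑ l, ‖z i l‖ ^ 2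
        = (tiltedPrecision S ω u r a a' * ((R * Matrix.of z) * (R * Matrix.of z)ᴴ)).trace.re
          - ((matF a)⁻¹ * ((R * Matrix.of z) * (R * Matrix.of z)ᴴ)).trace.re := by
      rw [trace_mul_mul_self_conjTranspose, trace_mul_mul_self_conjTranspose, hdiag,
        conjTranspose_mul_inv_mul_self hR hF]
      have h1 : (1 : Matrix (Fin n) (Fin n) ℂ) = diagonal fun _ => ((1 : ℝ) : ℂ) := by simp
      rw [h1, re_trace_diagonal_mul, re_trace_diagonal_mul, ← Finset.sum_sub_distrib]
      exact Finset.sum_congr rfl fun i _ => by ring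
    rw [e1]
    simp only [covMetric, of_mul_of, tiltedPrecision, Matrix.sub_mul, Matrix.add_mul,
      Matrix.smul_mul, trace_sub, trace_add, trace_smul, smul_eq_mul, Complex.sub_re,
      Complex.add_re, Complex.re_ofReal_mul, hc₀]
    ring
  calc _ ≤ iidGaussian (Fin n) (Fin L) 1 {z | 1 ≤ ENNReal.ofReal
          (Real.exp c₀) * ENNReal.ofReal (Real.exp (-∑ i, (d i - 1) * ∑ l, ‖z i l‖ ^ 2))} := by
        refine measure_mono fun z hz => ?_
        obtain ⟨hz1, hz2⟩ := hz
        rw [Set.mem_ofPred_eq, ← ENNReal.ofReal_mul (Real.exp_pos _).le, ← Real.exp_add, ← hexp z,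
          ENNReal.one_le_ofReal, Real.one_le_exp_iff]
        exact add_nonneg (mul_nonneg hu (sub_nonneg.2 hz1)) (mul_nonneg hr (sub_nonneg.2 hz2))
    _ ≤ ∫⁻ z, ENNReal.ofReal (Real.exp c₀) * ENNReal.ofReal
          (Real.exp (-∑ i, (d i - 1) * ∑ l, ‖z i l‖ ^ 2)) ∂(iidGaussian (Fin n) (Fin L) 1) := by
        have := mul_meas_ge_le_lintegral₀ (μ := iidGaussian (Fin n) (Fin L) 1)
          (f := fun z => ENNReal.ofReal (Real.exp c₀) * ENNReal.ofReal
            (Real.exp (-∑ i, (d i - 1) * ∑ l, ‖z i l‖ ^ 2)))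
          (Measurable.const_mul (by fun_prop) _).aemeasurable 1
        rwa [one_mul] at this
    _ = ENNReal.ofReal (chernoffValue L S ω ν (u, r) a a') := by
        rw [lintegral_const_mul' _ _ ENNReal.ofReal_ne_top, lintegral_exp_neg_sum_iidGaussian hpos,
          ← ENNReal.ofReal_mul (Real.exp_pos _).le, Fintype.card_fin]
        congr 1
        have hP : 0 < ∏ i, d i := Finset.prod_pos fun i _ => hpos i
        have h2 : (∏ i, d i)⁻¹ ^ L = Real.exp (-(L * Real.log (∏ i, d i))) := by
          rw [Real.exp_neg, Real.exp_nat_mul, Real.exp_log hP, inv_pow]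
        rw [h2, ← Real.exp_add, chernoffValue, ← Real.exp_add]
        congr 1
        have h3 : logDet (matB S ω u r a a') = Real.log (∏ i, d i) := by
          rw [logDet, hdet, Complex.ofReal_re]
        simp only [h3, hc₀]
        ring

theorem measure_confusion_le_q1Integrand (C : Matrix (Fin n) τ ℂ) (S : Finset (Fin Ka))
    (a : Fin Ka → Fin n → ℂ) (a' : Fin t → Fin n → ℂ) (hC : matF a = 1 + C * Cᴴ) (ω ν : ℝ) :
    ((iidGaussian τ (Fin L) 1).prod (iidGaussian (Fin n) (Fin L) 1)) (linearChannel C ⁻¹'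
      {y | covMetric (matF' S a a') y ≤ covMetric (matF a) y ∧
        covMetric (matF a) y ≤ ω * covMetric (matF1 S a) y + n * L * ν})
      ≤ ENNReal.ofReal (q1Integrand L S ω ν a a') := by
  have : Nonempty (admissible S ω a a') := ⟨⟨_, zero_mem_admissible S ω a a'⟩⟩
  rw [← ofReal_measureReal]
  refine ENNReal.ofReal_le_ofReal (le_ciInf fun p => ?_)
  have h := measure_confusion_le_chernoffValue (L := L) C S a a' hC ω ν p.2
  have hnn : 0 ≤ chernoffValue L S ω ν p a a' := by unfold chernoffValue; positivity
  exact ENNReal.toReal_le_of_le_ofReal hnn h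

/-- The event that the metric of the true covariance `F` exceeds `ω` times that of `F₁` by more
than `n L ν`. In the coordinates where `F₁ = R Rᴴ` and `A_{S₁} A_{S₁}ᴴ = R Δ Rᴴ` the received
signal is `R (I + Δ)^{1/2} Z`, and apart from `‖Z‖² > n L (1 + δ)` the event forces the quadratic
form with weights `Δ` to be small. -/
theorem measure_atypical_le [NeZero n] [NeZero L] (C : Matrix (Fin n) τ ℂ) (S : Finset (Fin Ka))
    (a : Fin Ka → Fin n → ℂ) (hC : matF a = 1 + C * Cᴴ) {m : ℕ} (hm : 0 < m)
    (hrank : (gram a S).rank = m) {ω : ℝ} (hω0 : 0 ≤ ω) (hω1 : ω ≤ 1) (ν δ : ℝ) :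
    ((iidGaussian τ (Fin L) 1).prod (iidGaussian (Fin n) (Fin L) 1)) (linearChannel C ⁻¹'
      {y | ω * covMetric (matF1 S a) y + n * L * ν < covMetric (matF a) y})
      ≤ ENNReal.ofReal (q2Integrand L m S ω ν δ a)
        + ENNReal.ofReal (1 - regGamma (n * L) (n * L * (1 + δ))) := by
  obtain ⟨R₀, d, hR₀, hF1, hG, hd, hcard, heig, -⟩ := exists_diagonalization_gram S a hrank
  -- `D = (I + diag d)^{1/2}`, so that `R₀ D` is a square root of `F`.
  set D : Matrix (Fin n) (Fin n) ℂ := diagonal fun i => ((√(1 + d i) : ℝ) : ℂ) with hD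
  have hDH : Dᴴ = D := by
    rw [hD, diagonal_conjTranspose]
    congr 1
    ext i
    simp
  have hDD : D * D = diagonal fun i => ((1 + d i : ℝ) : ℂ) := by
    rw [hD, diagonal_mul_diagonal]
    congr 1
    ext i
    rw [← Complex.ofReal_mul, Real.mul_self_sqrt (add_nonneg zero_le_one (hd i))]
  have hF : matF a = (R₀ * D) * (R₀ * D)ᴴ := by
    have h1 : (diagonal fun i => ((1 + d i : ℝ) : ℂ)) = 1 + diagonal fun i => (d i : ℂ) := by
      rw [← diagonal_one, diagonal_add]
      congr 1
      ext i
      simp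
    rw [conjTranspose_mul, hDH, Matrix.mul_assoc, ← Matrix.mul_assoc D, hDD, h1,
      matF_eq_matF1_add S, hG, Matrix.add_mul, Matrix.one_mul, Matrix.mul_add, ← hF1,
      Matrix.mul_assoc]
  have hDu : IsUnit D := by
    rw [Matrix.isUnit_iff_isUnit_det, hD, det_diagonal, isUnit_iff_ne_zero]
    refine Finset.prod_ne_zero_iff.2 fun i _ => ?_
    exact_mod_cast (Real.sqrt_pos.2 (add_pos_of_pos_of_nonneg one_pos (hd i))).ne'
  have hs : MeasurableSet
      {y : Received n L | ω * covMetric (matF1 S a) y + n * L * ν < covMetric (matF a) y} :=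
    measurableSet_lt (((continuous_covMetric _).measurable.const_mul _).add_const _)
      (continuous_covMetric _).measurable
  rw [measure_linearChannel_preimage C (hF.symm.trans hC) hs]
  have hmetF : ∀ z : Fin n → Fin L → ℂ,
      covMetric (matF a) (fun i l => ((R₀ * D) * Matrix.of z) i l)
        = L * logDet (matF a) + ∑ i, ∑ l, ‖z i l‖ ^ 2 := by
    intro z
    rw [covMetric, of_mul_of, trace_mul_mul_self_conjTranspose,
      conjTranspose_mul_inv_mul_self (hR₀.mul hDu) hF]
    have h1 : (1 : Matrix (Fin n) (Fin n) ℂ) = diagonal fun _ => ((1 : ℝ) : ℂ) := by simp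
    rw [h1, re_trace_diagonal_mul]
    simp
  have hmetF1 : ∀ z : Fin n → Fin L → ℂ,
      covMetric (matF1 S a) (fun i l => ((R₀ * D) * Matrix.of z) i l)
        = L * logDet (matF1 S a) + (∑ i, ∑ l, ‖z i l‖ ^ 2 + ∑ i, d i * ∑ l, ‖z i l‖ ^ 2) := by
    intro z
    have h1 : (R₀ * D)ᴴ * (matF1 S a)⁻¹ * (R₀ * D)
        = diagonal fun i => ((1 + d i : ℝ) : ℂ) := by
      rw [conjTranspose_mul, hDH, ← hDD]
      have := conjTranspose_mul_inv_mul_self hR₀ hF1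
      calc _ = D * (R₀ᴴ * (matF1 S a)⁻¹ * R₀) * D := by simp only [Matrix.mul_assoc]
        _ = _ := by rw [this, Matrix.mul_one]
    rw [covMetric, of_mul_of, trace_mul_mul_self_conjTranspose, h1, re_trace_diagonal_mul,
      ← Finset.sum_add_distrib]
    congr 1
    exact Finset.sum_congr rfl fun i _ => by ring
  -- Where `‖z‖² ≤ n L (1 + δ)`, the term `(1 - ω) ‖z‖²` is at most `(1 - ω) n L (1 + δ)`.
  have hsub : {z : Fin n → Fin L → ℂ | (fun i l => ((R₀ * D) * Matrix.of z) i l) ∈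
        {y : Received n L | ω * covMetric (matF1 S a) y + n * L * ν < covMetric (matF a) y}}
      ⊆ {z | ω * ∑ i, d i * ∑ l, ‖z i l‖ ^ 2 < L * q2Numerator S ω ν δ a}
        ∪ {z | n * L * (1 + δ) < ∑ i, ∑ l, ‖z i l‖ ^ 2} := by
    intro z hz
    simp only [Set.mem_ofPred_eq, hmetF, hmetF1] at hz
    simp only [Set.mem_union, Set.mem_ofPred_eq]
    by_contra! hcon
    obtain ⟨h1, h2⟩ := hcon
    have h3 := mul_le_mul_of_nonneg_left h2 (sub_nonneg.2 hω1)
    unfold q2Numerator at h1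
    nlinarith
  refine (measure_mono hsub).trans ((measure_union_le _ _).trans (add_le_add ?_ ?_))
  · rcases hω0.eq_or_lt with rfl | hω
    · rw [q2Integrand, if_pos rfl]
      have hL : (0 : ℝ) < L := by exact_mod_cast Nat.pos_of_neZero L
      by_cases hN : 0 < q2Numerator S 0 ν δ a
      · rw [if_pos hN, ENNReal.ofReal_one]
        exact prob_le_one
      · rw [if_neg hN]
        have : {z : Fin n → Fin L → ℂ | 0 * ∑ i, d i * ∑ l, ‖z i l‖ ^ 2
            < L * q2Numerator S 0 ν δ a} = ∅ := by
          ext z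
          simp only [zero_mul, Set.mem_ofPred_eq, Set.mem_empty_iff_false, iff_false, not_lt]
          exact mul_nonpos_of_nonneg_of_nonpos hL.le (not_lt.1 hN)
        rw [this, measure_empty]
        exact zero_le
    · have hg : 0 < (∏ i ∈ Finset.univ.filter (fun i => d i ≠ 0), d i) := Finset.prod_pos
        fun i hi => lt_of_le_of_ne (hd i) (Finset.mem_filter.1 hi).2.symm
      set g : ℝ := (∏ i ∈ Finset.univ.filter (fun i => d i ≠ 0), d i) ^ (1 / (m : ℝ)) with hgdef
      have hg0 : 0 < g := Real.rpow_pos_of_pos hg _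
      have hgm : g ^ m = ∏ i ∈ Finset.univ.filter (fun i => d i ≠ 0), d i := by
        rw [hgdef, ← Real.rpow_natCast, ← Real.rpow_mul hg.le, one_div,
          inv_mul_cancel₀ (by exact_mod_cast hm.ne'), Real.rpow_one]
      have key := iidGaussian_ellipsoid_le_regGamma (κ := Fin L) hd hm hcard hg0 hgm
        (L * q2Numerator S ω ν δ a / ω)
      have hset : {z : Fin n → Fin L → ℂ | ω * ∑ i, d i * ∑ l, ‖z i l‖ ^ 2
            < L * q2Numerator S ω ν δ a}
          = {z | ∑ i, d i * ∑ l, ‖z i l‖ ^ 2 < L * q2Numerator S ω ν δ a / ω} := by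
        ext z
        simp only [Set.mem_ofPred_eq]
        rw [lt_div_iff₀ hω, mul_comm]
      rw [hset]
      refine key.trans (le_of_eq ?_)
      rw [q2Integrand, if_neg hω.ne', heig, Real.rpow_neg hg.le, ← hgdef, Fintype.card_fin,
        mul_comm (m : ℝ)]
      congr 2
      field_simp
  · rw [iidGaussian_lt_normSq, Fintype.card_fin, Fintype.card_fin]

end Conditional

/-! ### The law of selected codewords -/

section Codewords

variable {n K M : ℕ}

/-- The law of the codebooks. -/
noncomputable def codebookLaw (n K M : ℕ) (v : ℝ) : Measure (Codebook n K M) :=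
  Measure.pi fun _ : Fin K => iidGaussian (Fin M) (Fin n) v

instance instProbabilityCodebookLaw (v : ℝ) : IsProbabilityMeasure (codebookLaw n K M v) := by
  unfold codebookLaw; infer_instance

/-- The codewords with the (user, message) labels `e j`. -/
def selectWords {ι : Type} (e : ι → Fin K × Fin M) (c : Codebook n K M) : ι → Fin n → ℂ :=
  fun j => c (e j).1 (e j).2

theorem continuous_selectWords {ι : Type} (e : ι → Fin K × Fin M) :
    Continuous (selectWords (n := n) e) :=
  continuous_pi fun j => (continuous_apply (e j).2).comp (continuous_apply (e j).1)

theorem measurable_selectWords {ι : Type} (e : ι → Fin K × Fin M) :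
    Measurable (selectWords (n := n) e) :=
  measurable_pi_lambda _ fun j => (measurable_pi_apply (e j).2).comp (measurable_pi_apply (e j).1)

theorem map_uncurry_pi {ι κ α : Type*} [Fintype ι] [Fintype κ] [MeasurableSpace α] (μ : Measure α)
    [IsProbabilityMeasure μ] :
    (Measure.pi fun _ : ι => Measure.pi fun _ : κ => μ).map (fun f (p : ι × κ) => f p.1 p.2)
      = Measure.pi fun _ : ι × κ => μ := by
  have hm : Measurable fun (f : ι → κ → α) (p : ι × κ) => f p.1 p.2 :=
    measurable_pi_lambda _ fun p => (measurable_pi_apply p.2).comp (measurable_pi_apply p.1)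
  refine (Measure.pi_eq fun s hs => ?_).symm
  rw [Measure.map_apply hm (MeasurableSet.univ_pi hs)]
  have h : (fun (f : ι → κ → α) (p : ι × κ) => f p.1 p.2) ⁻¹' Set.univ.pi s
      = Set.univ.pi fun i => Set.univ.pi fun k => s (i, k) := by
    ext f
    simp
  rw [h, Measure.pi_pi, Fintype.prod_prod_type]
  exact Finset.prod_congr rfl fun i _ => Measure.pi_pi _ _

/-- Codewords with distinct labels are independent. -/
theorem map_selectWords {ι : Type} [Fintype ι] (v : ℝ) {e : ι → Fin K × Fin M}
    (he : e.Injective) :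
    (codebookLaw n K M v).map (selectWords e) = iidGaussian ι (Fin n) v := by
  have h1 := map_uncurry_pi (ι := Fin K) (κ := Fin M) (Measure.pi fun _ : Fin n => complexGaussian v)
  have hm : Measurable fun (f : Codebook n K M) (p : Fin K × Fin M) => f p.1 p.2 :=
    measurable_pi_lambda _ fun p => (measurable_pi_apply p.2).comp (measurable_pi_apply p.1)
  have hm2 : Measurable fun (f : Fin K × Fin M → Fin n → ℂ) (j : ι) => f (e j) :=
    measurable_pi_lambda _ fun j => measurable_pi_apply (e j)
  rw [iidGaussian, ← map_comp_pi _ he, ← h1, Measure.map_map hm2 hm]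
  rfl

/-- Two families of codewords without a common label are independent. -/
theorem map_selectWords_prod {ι κ : Type} [Fintype ι] [Fintype κ] (v : ℝ)
    {e : ι → Fin K × Fin M} {f : κ → Fin K × Fin M} (hef : (Sum.elim e f).Injective) :
    (codebookLaw n K M v).map (fun c => (selectWords e c, selectWords f c))
      = (iidGaussian ι (Fin n) v).prod (iidGaussian κ (Fin n) v) := by
  have h := measurePreserving_sumPiEquivProdPi
    (fun _ : ι ⊕ κ => Measure.pi fun _ : Fin n => complexGaussian v)
  have h2 := h.map_eq
  have h3 := map_selectWords (n := n) v hef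
  rw [iidGaussian] at h3
  rw [← h3, Measure.map_map h.measurable (measurable_selectWords _)] at h2
  exact h2

end Codewords

/-! ### Error patterns -/

section Patterns

variable {n K Ka M L t : ℕ}

/-- The active users can be enumerated so that a prescribed set of indices enumerates a given set
of active users of the same size. -/
theorem exists_enumeration {act S' : Finset (Fin K)} (hact : act.card = Ka) (hS' : S' ⊆ act)
    {S₁ : Finset (Fin Ka)} (hcard : S'.card = S₁.card) :
    ∃ σ : Fin Ka → Fin K, σ.Injective ∧ Finset.univ.image σ = act ∧ S₁.image σ = S' := by
  classical
  let f : Fin Ka ≃ act := (Finset.equivFinOfCardEq hact).symm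
  let T : Finset (Fin Ka) := Finset.univ.filter fun j => (f j : Fin K) ∈ S'
  have hTimg : T.image (fun j => (f j : Fin K)) = S' := by
    ext k
    simp only [T, Finset.mem_image, Finset.mem_filter, Finset.mem_univ, true_and]
    constructor
    · rintro ⟨j, hj, rfl⟩; exact hj
    · intro hk
      exact ⟨f.symm ⟨k, hS' hk⟩, by simpa using hk, by simp⟩
  have hinj : Function.Injective fun j => (f j : Fin K) :=
    Subtype.val_injective.comp f.injective
  have hT : T.card = S₁.card := by
    rw [← hcard, ← hTimg, Finset.card_image_of_injective _ hinj]
  let e : {j // j ∈ S₁} ≃ {j // j ∈ T} := Finset.equivOfCardEq hT.symm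
  have hmem : ∀ j, e.extendSubtype j ∈ T ↔ j ∈ S₁ := fun j =>
    ⟨fun h => by_contra fun hj => e.extendSubtype_not_mem j hj h, fun h => e.extendSubtype_mem j h⟩
  refine ⟨fun j => f (e.extendSubtype j), hinj.comp e.extendSubtype.injective, ?_, ?_⟩
  · ext k
    simp only [Finset.mem_image, Finset.mem_univ, true_and]
    constructor
    · rintro ⟨j, rfl⟩; exact (f _).2
    · intro hk
      exact ⟨e.extendSubtype.symm (f.symm ⟨k, hk⟩), by simp⟩
  · rw [← hTimg]
    ext k
    simp only [Finset.mem_image]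
    constructor
    · rintro ⟨j, hj, rfl⟩; exact ⟨_, (hmem j).2 hj, rfl⟩
    · rintro ⟨j, hj, rfl⟩
      exact ⟨e.extendSubtype.symm j, (hmem _).1 (by simpa using hj), by simp⟩

/-- The active users whose message is not decoded correctly. -/
def misdecoded (act : Finset (Fin K)) (w : Fin K → Fin M) (d : Messages K M) : Finset (Fin K) :=
  act.filter fun k => d k ≠ some (w k)

theorem support_sent (act : Finset (Fin K)) (w : Fin K → Fin M) : support (sent act w) = act := by
  ext k
  simp [support, sent]

theorem codeword_of_eq_some (c : Codebook n K M) {d : Messages K M} {k : Fin K} {m : Fin M}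
    (h : d k = some m) : codeword c d k = c k m := by
  simp [codeword, h]

theorem codeword_of_eq_none (c : Codebook n K M) {d : Messages K M} {k : Fin K}
    (h : d k = none) : codeword c d k = 0 := by
  simp [codeword, h]

theorem sent_of_mem {act : Finset (Fin K)} (w : Fin K → Fin M) {k : Fin K} (hk : k ∈ act) :
    sent act w k = some (w k) := if_pos hk

theorem gram_selectWords_image {ι : Type} [DecidableEq ι] (c : Codebook n K M)
    (w : Fin K → Fin M) {σ : ι → Fin K} (hσ : σ.Injective) (S : Finset ι) :
    gram (selectWords (fun j => (σ j, w (σ j))) c) S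
      = ∑ k ∈ S.image σ, vecMulVec (c k (w k)) (star (c k (w k))) := by
  rw [Finset.sum_image fun _ _ _ _ h => hσ h]
  rfl

theorem decisionCov_sent (c : Codebook n K M) {act : Finset (Fin K)} (w : Fin K → Fin M)
    {σ : Fin Ka → Fin K} (hσ : σ.Injective) (himg : Finset.univ.image σ = act) :
    decisionCov c (sent act w) = matF (selectWords (fun j => (σ j, w (σ j))) c) := by
  rw [decisionCov, matF, gram_selectWords_image c w hσ, himg, support_sent]
  congr 1
  exact Finset.sum_congr rfl fun k hk => by rw [codeword_of_eq_some c (sent_of_mem w hk)]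

/-- The matrix whose columns are the codewords of all users, with a zero column for each inactive
user. -/
def signature (c : Codebook n K M) (d : Messages K M) : Matrix (Fin n) (Fin K) ℂ :=
  Matrix.of fun i k => codeword c d k i

theorem channelOutput_eq_linearChannel (c : Codebook n K M) (d : Messages K M)
    (p : (Fin K → Fin L → ℂ) × (Fin n → Fin L → ℂ)) :
    channelOutput c d p.1 p.2 = linearChannel (signature c d) p := by
  ext i l
  simp only [channelOutput, linearChannel, signature, mul_apply, of_apply]
  congr 1
  exact Finset.sum_congr rfl fun k _ => mul_comm _ _

theorem decisionCov_eq_signature (c : Codebook n K M) (d : Messages K M) :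
    decisionCov c d = 1 + signature c d * (signature c d)ᴴ := by
  rw [decisionCov]
  congr 1
  ext i j
  simp only [Matrix.sum_apply, vecMulVec_apply, mul_apply, signature, of_apply,
    conjTranspose_apply, Pi.star_apply]
  refine Finset.sum_subset (Finset.subset_univ _) fun k _ hk => ?_
  have : d k = none := by simpa [support] using hk
  simp [codeword_of_eq_none c this]

/-- Every decision with the right number of users arises from the transmitted messages by dropping
the misdecoded users and adding as many false alarms with arbitrary messages. The false alarms
carry other labels than the transmitted codewords. -/
theorem exists_falseAlarms (c : Codebook n K M) {act : Finset (Fin K)} (hact : act.card = Ka)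
    (w : Fin K → Fin M) {d : Messages K M} (hd : (support d).card = Ka)
    (ht : (misdecoded act w d).card = t) {σ : Fin Ka → Fin K} (hσ : σ.Injective)
    (himg : Finset.univ.image σ = act) {S₁ : Finset (Fin Ka)}
    (hS₁ : S₁.image σ = misdecoded act w d) :
    ∃ (S₂ : Finset (Fin K)) (h₂ : S₂.card = t) (m : Fin t → Fin M),
      S₂ ⊆ Finset.univ \ (act \ misdecoded act w d) ∧
      (Sum.elim (fun j => (σ j, w (σ j))) fun j => (S₂.orderEmbOfFin h₂ j, m j)).Injective ∧
      decisionCov c d = matF' S₁ (selectWords (fun j => (σ j, w (σ j))) c)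
        (selectWords (fun j => (S₂.orderEmbOfFin h₂ j, m j)) c) := by
  classical
  set S' := misdecoded act w d with hS'
  have hS'act : S' ⊆ act := Finset.filter_subset _ _
  have hcorrect : ∀ k ∈ act \ S', d k = some (w k) := by
    intro k hk
    rw [Finset.mem_sdiff] at hk
    by_contra h
    exact hk.2 (Finset.mem_filter.2 ⟨hk.1, h⟩)
  have hsub : act \ S' ⊆ support d := fun k hk => by
    simp [support, hcorrect k hk]
  have h₂ : (support d \ (act \ S')).card = t := by
    have h1 := Finset.card_sdiff_add_card_eq_card hsub
    have h2 := Finset.card_sdiff_add_card_eq_card hS'act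
    omega
  have hsome : ∀ j : Fin t, ∃ m, d ((support d \ (act \ S')).orderEmbOfFin h₂ j) = some m := by
    intro j
    have h1 := Finset.orderEmbOfFin_mem (support d \ (act \ S')) h₂ j
    rw [Finset.mem_sdiff] at h1
    have h2 := h1.1
    simp only [support, Finset.mem_filter, Finset.mem_univ, true_and] at h2
    exact Option.ne_none_iff_exists'.1 h2
  choose m hm using hsome
  refine ⟨support d \ (act \ S'), h₂, m, ?_, ?_, ?_⟩
  · exact Finset.sdiff_subset_sdiff (Finset.subset_univ _) le_rfl
  · refine Function.Injective.sumElim ?_ ?_ ?_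
    · intro i j h
      exact hσ (Prod.mk.inj h).1
    · intro i j h
      exact ((support d \ (act \ S')).orderEmbOfFin h₂).injective (Prod.mk.inj h).1
    · intro i j h
      obtain ⟨h1, h3⟩ := Prod.mk.inj h
      have hact' : σ i ∈ act := himg ▸ Finset.mem_image_of_mem σ (Finset.mem_univ i)
      have hmem := Finset.orderEmbOfFin_mem (support d \ (act \ S')) h₂ j
      rw [← h1, Finset.mem_sdiff, Finset.mem_sdiff, not_and, not_not] at hmem
      have hne : d (σ i) ≠ some (w (σ i)) := (Finset.mem_filter.1 (hmem.2 hact')).2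
      exact hne (by rw [h3, ← hm j, h1])
  · have e1 : gram (selectWords (fun j => (σ j, w (σ j))) c) (Finset.univ \ S₁)
        = ∑ k ∈ act \ S', vecMulVec (codeword c d k) (star (codeword c d k)) := by
      rw [gram_selectWords_image c w hσ, Finset.image_sdiff _ _ hσ, himg, hS₁]
      exact Finset.sum_congr rfl fun k hk => by rw [codeword_of_eq_some c (hcorrect k hk)]
    have e2 : gram (selectWords (fun j =>
          ((support d \ (act \ S')).orderEmbOfFin h₂ j, m j)) c) Finset.univ
        = ∑ k ∈ support d \ (act \ S'), vecMulVec (codeword c d k) (star (codeword c d k)) := by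
      conv_rhs => rw [← Finset.image_orderEmbOfFin_univ (support d \ (act \ S')) h₂]
      rw [Finset.sum_image fun _ _ _ _ h => (Finset.orderEmbOfFin _ h₂).injective h]
      exact Finset.sum_congr rfl fun j _ => by rw [codeword_of_eq_some c (hm j)]; rfl
    rw [decisionCov, matF', e1, e2, add_assoc, add_comm (∑ k ∈ act \ S', _),
      Finset.sum_sdiff hsub]

end Patterns

/-! ### The union bound -/

section UnionBound

variable {n K Ka M L t : ℕ}

/-- The law of the fading coefficients and the noise. -/
noncomputable def noiseLaw (n K L : ℕ) : Measure ((Fin K → Fin L → ℂ) × (Fin n → Fin L → ℂ)) :=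
  (iidGaussian (Fin K) (Fin L) 1).prod (iidGaussian (Fin n) (Fin L) 1)

instance instProbabilityNoiseLaw : IsProbabilityMeasure (noiseLaw n K L) := by
  unfold noiseLaw; infer_instance

theorem continuous_covMetric_comp {α : Type*} [TopologicalSpace α]
    {G : α → Matrix (Fin n) (Fin n) ℂ} (hG : Continuous G) (hpos : ∀ x, (G x).PosDef)
    {Y : α → Received n L} (hY : Continuous Y) : Continuous fun x => covMetric (G x) (Y x) := by
  have h0 : Continuous fun x => (Matrix.of (Y x) : Matrix (Fin n) (Fin L) ℂ) := hY
  have h1 := continuous_logDet hG hpos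
  have h2 : Continuous fun x => ((G x)⁻¹ * ((Matrix.of (Y x)) * (Matrix.of (Y x))ᴴ)).trace.re :=
    Complex.continuous_re.comp ((continuous_nonsing_inv hG hpos).matrix_mul
      (h0.matrix_mul h0.matrix_conjTranspose)).matrix_trace
  unfold covMetric
  fun_prop

theorem continuous_codeword (d : Messages K M) (k : Fin K) :
    Continuous fun c : Codebook n K M => codeword c d k := by
  rcases h : d k with _ | m
  · simp only [codeword_of_eq_none _ h]
    exact continuous_const
  · simp only [codeword_of_eq_some _ h]
    exact (continuous_apply m).comp (continuous_apply k)

theorem continuous_channelOutput (d : Messages K M) :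
    Continuous fun q : Codebook n K M × ((Fin K → Fin L → ℂ) × (Fin n → Fin L → ℂ)) =>
      channelOutput q.1 d q.2.1 q.2.2 := by
  refine continuous_pi fun i => continuous_pi fun l => ?_
  have h : ∀ k, Continuous fun q : Codebook n K M × ((Fin K → Fin L → ℂ) × (Fin n → Fin L → ℂ)) =>
      codeword q.1 d k i := fun k =>
    (continuous_apply i).comp ((continuous_codeword d k).comp continuous_fst)
  unfold channelOutput
  fun_prop

/-- The transmitted codewords, in the order given by the enumeration `σ` of the active users. -/
abbrev sentWords (w : Fin K → Fin M) (σ : Fin Ka → Fin K) (c : Codebook n K M) :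
    Fin Ka → Fin n → ℂ :=
  selectWords (fun j => (σ j, w (σ j))) c

theorem sentLabels_injective (w : Fin K → Fin M) {σ : Fin Ka → Fin K} (hσ : σ.Injective) :
    Function.Injective fun j => (σ j, w (σ j)) := fun _ _ h => hσ (Prod.mk.inj h).1

/-- The event that the metric of the transmitted codewords is untypically large compared to that
of the correctly decoded ones. -/
def atypicalEvent (L : ℕ) (act : Finset (Fin K)) (w : Fin K → Fin M) (σ : Fin Ka → Fin K)
    (S₁ : Finset (Fin Ka)) (ω ν : ℝ) :
    Set (Codebook n K M × ((Fin K → Fin L → ℂ) × (Fin n → Fin L → ℂ))) :=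
  {q | ω * covMetric (matF1 S₁ (sentWords w σ q.1)) (channelOutput q.1 (sent act w) q.2.1 q.2.2)
      + n * L * ν
    < covMetric (matF (sentWords w σ q.1)) (channelOutput q.1 (sent act w) q.2.1 q.2.2)}

/-- The event that replacing the codewords in `S₁` by the false alarms with labels `e` does not
increase the metric, while the received signal is typical. -/
def confusionEvent (L : ℕ) (act : Finset (Fin K)) (w : Fin K → Fin M) (σ : Fin Ka → Fin K)
    (S₁ : Finset (Fin Ka)) (e : Fin t → Fin K × Fin M) (ω ν : ℝ) :
    Set (Codebook n K M × ((Fin K → Fin L → ℂ) × (Fin n → Fin L → ℂ))) :=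
  {q | covMetric (matF' S₁ (sentWords w σ q.1) (selectWords e q.1))
        (channelOutput q.1 (sent act w) q.2.1 q.2.2)
      ≤ covMetric (matF (sentWords w σ q.1)) (channelOutput q.1 (sent act w) q.2.1 q.2.2) ∧
    covMetric (matF (sentWords w σ q.1)) (channelOutput q.1 (sent act w) q.2.1 q.2.2)
      ≤ ω * covMetric (matF1 S₁ (sentWords w σ q.1))
        (channelOutput q.1 (sent act w) q.2.1 q.2.2) + n * L * ν}

section Events

variable (act : Finset (Fin K)) (w : Fin K → Fin M) (σ : Fin Ka → Fin K) (S₁ : Finset (Fin Ka))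

theorem continuous_metric_matF :
    Continuous fun q : Codebook n K M × ((Fin K → Fin L → ℂ) × (Fin n → Fin L → ℂ)) =>
      covMetric (matF (sentWords w σ q.1)) (channelOutput q.1 (sent act w) q.2.1 q.2.2) :=
  continuous_covMetric_comp
    (continuous_matF.comp ((continuous_selectWords _).comp continuous_fst))
    (fun _ => posDef_matF _) (continuous_channelOutput _)

theorem continuous_metric_matF1 :
    Continuous fun q : Codebook n K M × ((Fin K → Fin L → ℂ) × (Fin n → Fin L → ℂ)) =>
      covMetric (matF1 S₁ (sentWords w σ q.1)) (channelOutput q.1 (sent act w) q.2.1 q.2.2) :=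
  continuous_covMetric_comp
    ((continuous_matF1 S₁).comp ((continuous_selectWords _).comp continuous_fst))
    (fun _ => posDef_matF1 _ _) (continuous_channelOutput _)

theorem continuous_metric_matF' (e : Fin t → Fin K × Fin M) :
    Continuous fun q : Codebook n K M × ((Fin K → Fin L → ℂ) × (Fin n → Fin L → ℂ)) =>
      covMetric (matF' S₁ (sentWords w σ q.1) (selectWords e q.1))
        (channelOutput q.1 (sent act w) q.2.1 q.2.2) :=
  continuous_covMetric_comp
    ((continuous_matF' S₁).comp (((continuous_selectWords _).comp continuous_fst).prodMk
      ((continuous_selectWords _).comp continuous_fst)))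
    (fun _ => posDef_matF' _ _ _) (continuous_channelOutput _)

theorem measurableSet_atypicalEvent (ω ν : ℝ) :
    MeasurableSet (atypicalEvent (n := n) L act w σ S₁ ω ν) :=
  measurableSet_lt (((continuous_metric_matF1 act w σ S₁).measurable.const_mul _).add_const _)
    (continuous_metric_matF act w σ).measurable

theorem measurableSet_confusionEvent (e : Fin t → Fin K × Fin M) (ω ν : ℝ) :
    MeasurableSet (confusionEvent (n := n) L act w σ S₁ e ω ν) :=
  (measurableSet_le (continuous_metric_matF' act w σ S₁ e).measurable
    (continuous_metric_matF act w σ).measurable).inter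
  (measurableSet_le (continuous_metric_matF act w σ).measurable
    (((continuous_metric_matF1 act w σ S₁).measurable.const_mul _).add_const _))

end Events

theorem matF_sentWords (c : Codebook n K M) {act : Finset (Fin K)} (w : Fin K → Fin M)
    {σ : Fin Ka → Fin K} (hσ : σ.Injective) (himg : Finset.univ.image σ = act) :
    matF (sentWords w σ c) = 1 + signature c (sent act w) * (signature c (sent act w))ᴴ := by
  rw [← decisionCov_eq_signature, decisionCov_sent c w hσ himg]

/-- The bound for a fixed codebook, averaged over the codebooks. -/
theorem measure_confusionEvent_le {v : ℝ} {act : Finset (Fin K)} (w : Fin K → Fin M)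
    {σ : Fin Ka → Fin K} (hσ : σ.Injective) (himg : Finset.univ.image σ = act)
    (S₁ : Finset (Fin Ka)) {e : Fin t → Fin K × Fin M}
    (he : (Sum.elim (fun j => (σ j, w (σ j))) e).Injective) (ω ν : ℝ) :
    ((codebookLaw n K M v).prod (noiseLaw n K L)) (confusionEvent L act w σ S₁ e ω ν)
      ≤ ENNReal.ofReal (∫ p : (Fin Ka → Fin n → ℂ) × (Fin t → Fin n → ℂ),
          q1Integrand L S₁ ω ν p.1 p.2
          ∂((iidGaussian (Fin Ka) (Fin n) v).prod (iidGaussian (Fin t) (Fin n) v))) := by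
  have hm := measurable_q1Integrand (n := n) (t := t) L S₁ ω ν
  have hint : Integrable (fun p : (Fin Ka → Fin n → ℂ) × (Fin t → Fin n → ℂ) =>
      q1Integrand L S₁ ω ν p.1 p.2)
      ((iidGaussian (Fin Ka) (Fin n) v).prod (iidGaussian (Fin t) (Fin n) v)) := by
    refine Integrable.of_bound hm.aestronglyMeasurable 1 (ae_of_all _ fun p => ?_)
    rw [Real.norm_of_nonneg (q1Integrand_nonneg _ _ _ _ _ _)]
    exact q1Integrand_le_one _ _ _ _ _ _
  rw [Measure.prod_apply (measurableSet_confusionEvent act w σ S₁ e ω ν),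
    ofReal_integral_eq_lintegral_ofReal hint (ae_of_all _ fun p => q1Integrand_nonneg _ _ _ _ _ _),
    ← map_selectWords_prod v he, lintegral_map hm.ennreal_ofReal
      ((measurable_selectWords _).prodMk (measurable_selectWords _))]
  refine lintegral_mono fun c => ?_
  have h := measure_confusion_le_q1Integrand (L := L) (signature c (sent act w)) S₁
    (sentWords w σ c) (selectWords e c) (matF_sentWords c w hσ himg) ω ν
  refine le_of_eq_of_le (congrArg (noiseLaw n K L) ?_) h
  ext p
  simp only [confusionEvent, Set.mem_preimage, Set.mem_ofPred_eq, channelOutput_eq_linearChannel]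

/-- The bound for a fixed codebook, averaged over the codebooks. The rank condition of
`measure_atypical_le` holds for almost all of them. -/
theorem measure_atypicalEvent_le [NeZero n] [NeZero L] {v : ℝ} (hv : 0 < v)
    {act : Finset (Fin K)} (w : Fin K → Fin M) {σ : Fin Ka → Fin K} (hσ : σ.Injective)
    (himg : Finset.univ.image σ = act) (ht : 0 < t) {S₁ : Finset (Fin Ka)} (hS₁ : S₁.card = t)
    {ω : ℝ} (hω0 : 0 ≤ ω) (hω1 : ω ≤ 1) (ν δ : ℝ) :
    ((codebookLaw n K M v).prod (noiseLaw n K L)) (atypicalEvent L act w σ S₁ ω ν)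
      ≤ ENNReal.ofReal (∫ a : Fin Ka → Fin n → ℂ, q2Integrand L (min n t) S₁ ω ν δ a
          ∂(iidGaussian (Fin Ka) (Fin n) v))
        + ENNReal.ofReal (1 - regGamma (n * L) (n * L * (1 + δ))) := by
  have hm0 : 0 < min n t := lt_min (Nat.pos_of_neZero n) ht
  have hL := Nat.pos_of_neZero L
  have hm := aemeasurable_q2Integrand (n := n) hv hL hm0 S₁ (by rw [hS₁]) ω ν δ
  have hI := fun a : Fin Ka → Fin n → ℂ => q2Integrand_mem_Icc hL hm0 S₁ ω ν δ a
  have hint : Integrable (fun a : Fin Ka → Fin n → ℂ => q2Integrand L (min n t) S₁ ω ν δ a)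
      (iidGaussian (Fin Ka) (Fin n) v) := by
    refine Integrable.of_bound hm.aestronglyMeasurable 1 (ae_of_all _ fun a => ?_)
    rw [Real.norm_of_nonneg (hI a).1]
    exact (hI a).2
  have hmap := map_selectWords (n := n) v (sentLabels_injective w hσ)
  have hrank : ∀ᵐ c ∂(codebookLaw n K M v), (gram (sentWords w σ c) S₁).rank = min n t := by
    have h := ae_rank_gram (n := n) hv S₁
    rw [← hmap, hS₁] at h
    exact ae_of_ae_map (measurable_selectWords _).aemeasurable h
  rw [← hmap] at hm
  rw [Measure.prod_apply (measurableSet_atypicalEvent act w σ S₁ ω ν),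
    ofReal_integral_eq_lintegral_ofReal hint (ae_of_all _ fun a => (hI a).1),
    ← hmap, lintegral_map' hm.ennreal_ofReal (measurable_selectWords _).aemeasurable]
  calc _ ≤ ∫⁻ c, (ENNReal.ofReal (q2Integrand L (min n t) S₁ ω ν δ (sentWords w σ c))
          + ENNReal.ofReal (1 - regGamma (n * L) (n * L * (1 + δ)))) ∂(codebookLaw n K M v) := by
        refine lintegral_mono_ae ?_
        filter_upwards [hrank] with c hc
        have h := measure_atypical_le (L := L) (signature c (sent act w)) S₁
          (sentWords w σ c) (matF_sentWords c w hσ himg) hm0 hc hω0 hω1 ν δ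
        refine le_of_eq_of_le (congrArg (noiseLaw n K L) ?_) h
        ext p
        simp only [atypicalEvent, Set.mem_preimage, Set.mem_ofPred_eq,
          channelOutput_eq_linearChannel]
    _ = _ := by
        rw [lintegral_add_right _ measurable_const]
        simp

/-- If exactly `t` users are misdecoded, then one of the atypical or confusion events occurs. The
atypical events are indexed by the set of misdecoded users only; the confusion events also by the
set of falsely decoded users and by their messages. -/
theorem measure_card_misdecoded_le [NeZero n] [NeZero L] {v : ℝ} (hv : 0 < v)
    {act : Finset (Fin K)} (hact : act.card = Ka) {dec : Codebook n K M → Received n L → Messages K M}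
    (hdec : IsMLDecoder Ka dec) (w : Fin K → Fin M) (ht : 0 < t) {S₁ : Finset (Fin Ka)}
    (hS₁ : S₁.card = t) {ω : ℝ} (hω0 : 0 ≤ ω) (hω1 : ω ≤ 1) (ν δ : ℝ) :
    ((codebookLaw n K M v).prod (noiseLaw n K L))
        {q | (misdecoded act w (dec q.1 (channelOutput q.1 (sent act w) q.2.1 q.2.2))).card = t}
      ≤ ENNReal.ofReal (q1 n K Ka M L t v S₁ ω ν +
        ((Ka.choose t : ℝ) * (∫ a : Fin Ka → Fin n → ℂ, q2Integrand L (min n t) S₁ ω ν δ a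
          ∂(iidGaussian (Fin Ka) (Fin n) v))
        + (Ka.choose t : ℝ) * (1 - regGamma (n * L) (n * L * (1 + δ))))) := by
  classical
  -- Enumerations of the active users that turn each set `S'` of `t` of them into the fixed set `S₁`
  -- of indices.
  have hσ : ∀ S' : ↥(Finset.powersetCard t act), ∃ σ : Fin Ka → Fin K, σ.Injective ∧
      Finset.univ.image σ = act ∧ S₁.image σ = S' := fun S' => by
    obtain ⟨h1, h2⟩ := Finset.mem_powersetCard.1 S'.2
    exact exists_enumeration hact h1 (h2.trans hS₁.symm)
  choose σ hσinj hσact hσS using hσ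
  set μ := (codebookLaw n K M v).prod (noiseLaw n K L) with hμ
  set e : (S' : ↥(Finset.powersetCard t act)) →
      ↥(Finset.powersetCard t (Finset.univ \ (act \ S'.1))) → (Fin t → Fin M) →
      Fin t → Fin K × Fin M :=
    fun S' S₂ m j => (S₂.1.orderEmbOfFin (Finset.mem_powersetCard.1 S₂.2).2 j, m j) with he
  set Q := ∫ p : (Fin Ka → Fin n → ℂ) × (Fin t → Fin n → ℂ), q1Integrand L S₁ ω ν p.1 p.2
    ∂((iidGaussian (Fin Ka) (Fin n) v).prod (iidGaussian (Fin t) (Fin n) v)) with hQ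
  set A := ∫ a : Fin Ka → Fin n → ℂ, q2Integrand L (min n t) S₁ ω ν δ a
    ∂(iidGaussian (Fin Ka) (Fin n) v) with hA
  set B := 1 - regGamma (n * L) (n * L * (1 + δ)) with hB
  have hL := Nat.pos_of_neZero L
  have hn := Nat.pos_of_neZero n
  have hQ0 : 0 ≤ Q := integral_nonneg fun p => q1Integrand_nonneg _ _ _ _ _ _
  have hA0 : 0 ≤ A := integral_nonneg fun a =>
    (q2Integrand_mem_Icc hL (lt_min hn ht) S₁ ω ν δ a).1
  have hB0 : 0 ≤ B := sub_nonneg.2 (regGamma_le_one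
    (by exact_mod_cast Nat.mul_pos hn hL) _)
  -- Label families that are not injective cannot arise from a decision; they are indexed as well,
  -- with an empty event.
  have hcover : {q : Codebook n K M × ((Fin K → Fin L → ℂ) × (Fin n → Fin L → ℂ)) |
        (misdecoded act w (dec q.1 (channelOutput q.1 (sent act w) q.2.1 q.2.2))).card = t}
      ⊆ ⋃ S', (atypicalEvent L act w (σ S') S₁ ω ν ∪ ⋃ S₂, ⋃ m : Fin t → Fin M,
        {q | (Sum.elim (fun j => (σ S' j, w (σ S' j))) (e S' S₂ m)).Injective ∧
          q ∈ confusionEvent L act w (σ S') S₁ (e S' S₂ m) ω ν}) := by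
    intro q hq
    set y := channelOutput q.1 (sent act w) q.2.1 q.2.2 with hy
    set d := dec q.1 y with hd
    have hsub : misdecoded act w d ⊆ act := Finset.filter_subset _ _
    set S' : ↥(Finset.powersetCard t act) :=
      ⟨misdecoded act w d, Finset.mem_powersetCard.2 ⟨hsub, hq⟩⟩ with hS'
    obtain ⟨S₂, h₂, m, hS₂, hinj, hcov⟩ := exists_falseAlarms q.1 hact w
      (hdec.card_support q.1 y) hq (hσinj S') (hσact S') (hσS S')
    refine Set.mem_iUnion.2 ⟨S', ?_⟩
    by_cases hat : q ∈ atypicalEvent L act w (σ S') S₁ ω ν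
    · exact Or.inl hat
    · refine Or.inr (Set.mem_iUnion.2 ⟨⟨S₂, Finset.mem_powersetCard.2 ⟨hS₂, h₂⟩⟩,
        Set.mem_iUnion.2 ⟨m, hinj, ?_, not_lt.1 hat⟩⟩)
      have hml := hdec.metric_le q.1 y (sent act w) (by rw [support_sent, hact])
      have h1 : mlMetric q.1 y (sent act w) = covMetric (matF (sentWords w (σ S') q.1)) y := by
        rw [← decisionCov_sent q.1 w (hσinj S') (hσact S')]; rfl
      have h2 : mlMetric q.1 y d = covMetric (matF' S₁ (sentWords w (σ S') q.1)
          (selectWords (fun j => (S₂.orderEmbOfFin h₂ j, m j)) q.1)) y := by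
        rw [← hcov]; rfl
      rw [h1] at hml
      exact h2.symm.le.trans hml
  have hconf : ∀ S' S₂ m, μ {q | (Sum.elim (fun j => (σ S' j, w (σ S' j))) (e S' S₂ m)).Injective ∧
          q ∈ confusionEvent L act w (σ S') S₁ (e S' S₂ m) ω ν} ≤ ENNReal.ofReal Q := by
    intro S' S₂ m
    by_cases hinj : (Sum.elim (fun j => (σ S' j, w (σ S' j))) (e S' S₂ m)).Injective
    · simp only [hinj, true_and]
      exact measure_confusionEvent_le w (hσinj S') (hσact S') S₁ hinj ω ν
    · simp [hinj]
  have hS'card : ∀ S' : ↥(Finset.powersetCard t act),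
      (Finset.univ \ (act \ S'.1)).card = K - Ka + t := by
    intro S'
    obtain ⟨h1, h2⟩ := Finset.mem_powersetCard.1 S'.2
    have h3 := Finset.card_sdiff_add_card_eq_card h1
    have h4 := Finset.card_sdiff_add_card_eq_card (Finset.subset_univ (act \ S'.1))
    have h5 : act.card ≤ K := by simpa using Finset.card_le_univ act
    rw [Finset.card_univ, Fintype.card_fin] at h4
    omega
  calc μ _ ≤ ∑ S' : ↥(Finset.powersetCard t act), ((ENNReal.ofReal A + ENNReal.ofReal B)
          + ∑ S₂ : ↥(Finset.powersetCard t (Finset.univ \ (act \ S'.1))),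
            ∑ _m : Fin t → Fin M, ENNReal.ofReal Q) := by
        refine (measure_mono hcover).trans ((measure_iUnion_fintype_le _ _).trans
          (Finset.sum_le_sum fun S' _ => (measure_union_le _ _).trans (add_le_add ?_ ?_)))
        · exact measure_atypicalEvent_le hv w (hσinj S') (hσact S') ht hS₁ hω0 hω1 ν δ
        · exact (measure_iUnion_fintype_le _ _).trans (Finset.sum_le_sum fun S₂ _ =>
            (measure_iUnion_fintype_le _ _).trans (Finset.sum_le_sum fun m _ => hconf S' S₂ m))
    _ = (Ka.choose t : ENNReal) * ((ENNReal.ofReal A + ENNReal.ofReal B)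
          + ((K - Ka + t).choose t : ENNReal) * ((M : ENNReal) ^ t * ENNReal.ofReal Q)) := by
        simp only [Finset.sum_const, Finset.card_univ, Fintype.card_coe, Finset.card_powersetCard,
          hS'card, hact, nsmul_eq_mul, Fintype.card_fun, Fintype.card_fin]
        push_cast
        rfl
    _ = _ := by
        rw [q1, ← hQ]
        have c1 : (Ka.choose t : ENNReal) = ENNReal.ofReal (Ka.choose t : ℝ) := by simp
        have c2 : ((K - Ka + t).choose t : ENNReal) = ENNReal.ofReal ((K - Ka + t).choose t : ℝ) := by
          simp
        have c3 : (M : ENNReal) ^ t = ENNReal.ofReal ((M : ℝ) ^ t) := by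
          rw [ENNReal.ofReal_pow (Nat.cast_nonneg M)]; simp
        rw [c1, c2, c3, ← ENNReal.ofReal_mul (by positivity), ← ENNReal.ofReal_mul (by positivity),
          ← ENNReal.ofReal_add hA0 hB0, ← ENNReal.ofReal_add (by positivity) (by positivity),
          ← ENNReal.ofReal_mul (by positivity)]
        congr 1
        ring

end UnionBound

/-! ### From fixed messages to the random experiment -/

section Experiment

variable {n K Ka M L t : ℕ}

/-- There are only finitely many messages, so it suffices to treat each choice separately. -/
theorem measurable_of_fixed_messages {β : Type*} [MeasurableSpace β] {f : Sample n K M L → β}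
    (hf : ∀ w, Measurable fun q : Codebook n K M × ((Fin K → Fin L → ℂ) × (Fin n → Fin L → ℂ)) =>
      f (q.1, w, q.2)) : Measurable f := by
  have h1 : Measurable fun r : (Fin K → Fin M) ×
      (Codebook n K M × ((Fin K → Fin L → ℂ) × (Fin n → Fin L → ℂ))) => f (r.2.1, r.1, r.2.2) :=
    measurable_from_prod_countable_right hf
  exact h1.comp (measurable_snd.fst.prodMk (measurable_fst.prodMk measurable_snd.snd))

instance instProbabilityUniformMessages [NeZero M] :
    IsProbabilityMeasure (uniformOn (Set.univ : Set (Fin M))) :=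
  isProbabilityMeasure_uniformOn Set.finite_univ Set.univ_nonempty

instance instProbabilitySampleLaw [NeZero M] (v : ℝ) :
    IsProbabilityMeasure (sampleLaw n K M L v) := by
  unfold sampleLaw; infer_instance

/-- A bound that holds for each choice of the messages holds for random messages. -/
theorem sampleLaw_le_of_fixed_messages [NeZero M] (v : ℝ) {E : Set (Sample n K M L)}
    (hE : MeasurableSet E) {C : ENNReal}
    (h : ∀ w, ((codebookLaw n K M v).prod (noiseLaw n K L)) {q | (q.1, w, q.2) ∈ E} ≤ C) :
    sampleLaw n K M L v E ≤ C := by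
  have hslice : Measurable fun r : Codebook n K M × (Fin K → Fin M) =>
      noiseLaw n K L {z | (r.1, r.2, z) ∈ E} :=
    measurable_measure_prodMk_left (MeasurableEquiv.prodAssoc.measurable hE)
  calc sampleLaw n K M L v E
      = ∫⁻ c, ∫⁻ w, noiseLaw n K L {z | (c, w, z) ∈ E}
          ∂(Measure.pi fun _ : Fin K => uniformOn (Set.univ : Set (Fin M)))
          ∂(codebookLaw n K M v) := by
        refine (Measure.prod_apply hE).trans (lintegral_congr fun c => ?_)
        exact Measure.prod_apply (measurable_prodMk_left hE)
    _ = ∫⁻ w, ∫⁻ c, noiseLaw n K L {z | (c, w, z) ∈ E} ∂(codebookLaw n K M v)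
          ∂(Measure.pi fun _ : Fin K => uniformOn (Set.univ : Set (Fin M))) :=
        lintegral_lintegral_swap hslice.aemeasurable
    _ ≤ ∫⁻ _w, C ∂(Measure.pi fun _ : Fin K => uniformOn (Set.univ : Set (Fin M))) := by
        refine lintegral_mono fun w => le_trans (le_of_eq ?_) (h w)
        exact (Measure.prod_apply ((measurable_fst.prodMk (measurable_const.prodMk measurable_snd) :
          Measurable fun q : Codebook n K M × ((Fin K → Fin L → ℂ) × (Fin n → Fin L → ℂ)) =>
            (q.1, w, q.2)) hE)).symm
    _ = C := by simp

/-- The decision that is made if the active users send the codewords of the unconstrained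
codebooks. -/
abbrev unconstrainedDecision (dec : Codebook n K M → Received n L → Messages K M)
    (act : Finset (Fin K)) (s : Sample n K M L) : Messages K M :=
  dec s.1 (channelOutput s.1 (sent act s.2.1) s.2.2.1 s.2.2.2)

theorem measurableSet_unconstrainedDecision {dec : Codebook n K M → Received n L → Messages K M}
    (hdec : IsMLDecoder Ka dec) (act : Finset (Fin K))
    (p : (Fin K → Fin M) → Messages K M → Prop) :
    MeasurableSet {s : Sample n K M L | p s.2.1 (unconstrainedDecision dec act s)} := by
  have h1 : Measurable fun s : Sample n K M L =>
      (s.1, channelOutput s.1 (sent act s.2.1) s.2.2.1 s.2.2.2) :=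
    measurable_of_fixed_messages fun w =>
      measurable_fst.prodMk (continuous_channelOutput (sent act w)).measurable
  have h2 : {s : Sample n K M L | p s.2.1 (unconstrainedDecision dec act s)}
      = ⋃ w, ⋃ d, ⋃ _ : p w d, {s | s.2.1 = w} ∩ {s | unconstrainedDecision dec act s = d} := by
    ext s
    simp only [Set.mem_ofPred_eq, Set.mem_iUnion, Set.mem_inter_iff]
    exact ⟨fun h => ⟨_, _, h, rfl, rfl⟩, by rintro ⟨w, d, h, rfl, rfl⟩; exact h⟩
  rw [h2]
  refine MeasurableSet.iUnion fun w => MeasurableSet.iUnion fun d => MeasurableSet.iUnion fun _ => ?_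
  exact (measurable_snd.fst (measurableSet_singleton w)).inter (h1 (hdec.measurableSet_eq d))

theorem q1_nonneg (v : ℝ) (S₁ : Finset (Fin Ka)) (ω ν : ℝ) :
    0 ≤ q1 n K Ka M L t v S₁ ω ν := by
  have : 0 ≤ ∫ p : (Fin Ka → Fin n → ℂ) × (Fin t → Fin n → ℂ), q1Integrand L S₁ ω ν p.1 p.2
      ∂((iidGaussian (Fin Ka) (Fin n) v).prod (iidGaussian (Fin t) (Fin n) v)) :=
    integral_nonneg fun p => q1Integrand_nonneg _ _ _ _ _ _
  unfold q1
  positivity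

theorem sampleLaw_card_misdecoded_le [NeZero n] [NeZero L] [NeZero M] {v : ℝ} (hv : 0 < v)
    {act : Finset (Fin K)} (hact : act.card = Ka)
    {dec : Codebook n K M → Received n L → Messages K M} (hdec : IsMLDecoder Ka dec) (ht : 0 < t)
    {S₁ : Finset (Fin Ka)} (hS₁ : S₁.card = t) :
    (sampleLaw n K M L v).real
        {s | (misdecoded act s.2.1 (unconstrainedDecision dec act s)).card = t}
      ≤ min 1 (pt n K Ka M L t v S₁) := by
  refine le_min measureReal_le_one ?_
  have : Nonempty (Set.Icc (0 : ℝ) 1) := ⟨⟨0, by simp⟩⟩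
  have : Nonempty (Set.Ici (0 : ℝ)) := ⟨⟨0, by simp⟩⟩
  refine le_ciInf fun ⟨⟨ω, hω0, hω1⟩, ⟨ν, _⟩⟩ => sub_le_iff_le_add'.1 (le_ciInf fun ⟨δ, _⟩ =>
    sub_le_iff_le_add'.2 ?_)
  have hL := Nat.pos_of_neZero L
  have hn := Nat.pos_of_neZero n
  have hA : 0 ≤ ∫ a : Fin Ka → Fin n → ℂ, q2Integrand L (min n t) S₁ ω ν δ a
      ∂(iidGaussian (Fin Ka) (Fin n) v) := integral_nonneg fun a =>
    (q2Integrand_mem_Icc hL (lt_min hn ht) S₁ ω ν δ a).1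
  have hB : 0 ≤ 1 - regGamma (n * L) (n * L * (1 + δ)) := sub_nonneg.2 (regGamma_le_one
    (by exact_mod_cast Nat.mul_pos hn hL) _)
  refine ENNReal.toReal_le_of_le_ofReal (add_nonneg (q1_nonneg _ _ _ _) (by positivity)) ?_
  exact sampleLaw_le_of_fixed_messages v
    (measurableSet_unconstrainedDecision hdec act fun w d => (misdecoded act w d).card = t)
    fun w => measure_card_misdecoded_le hv hact hdec w ht hS₁ hω0 hω1 ν δ

/-- The event that some transmitted codeword violates the power constraint. -/
def powerViolation (n K M L : ℕ) (P : ℝ) (act : Finset (Fin K)) : Set (Sample n K M L) :=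
  ⋃ k ∈ act, {s | n * P < ∑ i, ‖s.1 k (s.2.1 k) i‖ ^ 2}

theorem sampleLaw_powerViolation_le [NeZero n] [NeZero M] (P : ℝ) {v : ℝ} (hv : 0 < v)
    {act : Finset (Fin K)} (hact : act.card = Ka) :
    (sampleLaw n K M L v).real (powerViolation n K M L P act) ≤ p0 n Ka P v := by
  have hn := Nat.pos_of_neZero n
  have hB : 0 ≤ 1 - regGamma n (n * P / v) :=
    sub_nonneg.2 (regGamma_le_one (by exact_mod_cast hn) _)
  have hcode : ∀ (k : Fin K) (m : Fin M),
      codebookLaw n K M v {c | n * P < ∑ i, ‖c k m i‖ ^ 2}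
        = ENNReal.ofReal (1 - regGamma n (n * P / v)) := by
    intro k m
    have hmp := (measurePreserving_eval (fun _ : Fin M =>
      Measure.pi fun _ : Fin n => complexGaussian v) m).comp
      (measurePreserving_eval (fun _ : Fin K => iidGaussian (Fin M) (Fin n) v) k)
    have hset : MeasurableSet {z : Fin n → ℂ | n * P < ∑ i, ‖z i‖ ^ 2} :=
      measurableSet_lt measurable_const (by fun_prop)
    have h := hmp.measure_preimage hset.nullMeasurableSet
    have h2 := pi_complexGaussian_lt_normSq (ι := Fin n) hv (n * P)
    rw [Fintype.card_fin] at h2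
    rw [h2] at h
    exact h
  have hE : ∀ k : Fin K,
      MeasurableSet {s : Sample n K M L | n * P < ∑ i, ‖s.1 k (s.2.1 k) i‖ ^ 2} := fun k =>
    measurableSet_lt measurable_const <| measurable_of_fixed_messages fun w => by
      dsimp only
      fun_prop
  have hk : ∀ k : Fin K, (sampleLaw n K M L v).real
      {s : Sample n K M L | n * P < ∑ i, ‖s.1 k (s.2.1 k) i‖ ^ 2}
        ≤ 1 - regGamma n (n * P / v) := fun k => by
    refine ENNReal.toReal_le_of_le_ofReal hB (sampleLaw_le_of_fixed_messages v (hE k) fun w => ?_)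
    rw [← hcode k (w k)]
    have : {q : Codebook n K M × ((Fin K → Fin L → ℂ) × (Fin n → Fin L → ℂ)) |
        (q.1, w, q.2) ∈ {s : Sample n K M L | n * P < ∑ i, ‖s.1 k (s.2.1 k) i‖ ^ 2}}
        = {c : Codebook n K M | n * P < ∑ i, ‖c k (w k) i‖ ^ 2} ×ˢ Set.univ := by
      ext q; simp
    rw [this, Measure.prod_prod, measure_univ, mul_one]
  calc _ ≤ ∑ k ∈ act, (sampleLaw n K M L v).real
        {s : Sample n K M L | n * P < ∑ i, ‖s.1 k (s.2.1 k) i‖ ^ 2} :=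
        measureReal_biUnion_finset_le _ _
    _ ≤ ∑ _k ∈ act, (1 - regGamma n (n * P / v)) := Finset.sum_le_sum fun k _ => hk k
    _ = p0 n Ka P v := by rw [Finset.sum_const, hact, nsmul_eq_mul, p0]

theorem receivedSignal_of_notMem_powerViolation {P : ℝ} {act : Finset (Fin K)}
    {s : Sample n K M L} (hs : s ∉ powerViolation n K M L P act) :
    receivedSignal P act s = channelOutput s.1 (sent act s.2.1) s.2.2.1 s.2.2.2 := by
  have h : ∀ k, codeword (constrained P s.1) (sent act s.2.1) k
      = codeword s.1 (sent act s.2.1) k := by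
    intro k
    by_cases hk : k ∈ act
    · rw [codeword_of_eq_some _ (sent_of_mem _ hk), codeword_of_eq_some _ (sent_of_mem _ hk)]
      refine if_pos (not_lt.1 fun hlt => hs ?_)
      exact Set.mem_iUnion₂.2 ⟨k, hk, hlt⟩
    · rw [codeword_of_eq_none _ (if_neg hk), codeword_of_eq_none _ (if_neg hk)]
  funext i l
  unfold receivedSignal channelOutput
  simp only [h]

/-- The error probabilities of the active users add up to the expected number of misdecoded
users. -/
theorem sum_measureReal_misdecoded [NeZero M] (v : ℝ) {act : Finset (Fin K)}
    (hact : act.card = Ka) {dec : Codebook n K M → Received n L → Messages K M}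
    (hdec : IsMLDecoder Ka dec) :
    ∑ k ∈ act, (sampleLaw n K M L v).real
        {s | unconstrainedDecision dec act s k ≠ some (s.2.1 k)}
      = ∑ t ∈ Finset.Icc 1 Ka, (t : ℝ) * (sampleLaw n K M L v).real
        {s | (misdecoded act s.2.1 (unconstrainedDecision dec act s)).card = t} := by
  classical
  have hE : ∀ k, MeasurableSet {s : Sample n K M L |
      unconstrainedDecision dec act s k ≠ some (s.2.1 k)} := fun k =>
    measurableSet_unconstrainedDecision hdec act fun w d => d k ≠ some (w k)
  have hT : ∀ t : ℕ, MeasurableSet {s : Sample n K M L |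
      (misdecoded act s.2.1 (unconstrainedDecision dec act s)).card = t} := fun t =>
    measurableSet_unconstrainedDecision hdec act fun w d => (misdecoded act w d).card = t
  have e1 : ∀ k, (sampleLaw n K M L v).real
        {s | unconstrainedDecision dec act s k ≠ some (s.2.1 k)}
      = ∫ s, {s | unconstrainedDecision dec act s k ≠ some (s.2.1 k)}.indicator
          (fun _ => (1 : ℝ)) s ∂(sampleLaw n K M L v) := fun k => by
    rw [integral_indicator_const _ (hE k)]; simp
  have e2 : ∀ t : ℕ, (t : ℝ) * (sampleLaw n K M L v).real
        {s | (misdecoded act s.2.1 (unconstrainedDecision dec act s)).card = t}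
      = ∫ s, {s | (misdecoded act s.2.1 (unconstrainedDecision dec act s)).card = t}.indicator
          (fun _ => (t : ℝ)) s ∂(sampleLaw n K M L v) := fun t => by
    rw [integral_indicator_const _ (hT t)]; simp [mul_comm]
  simp only [e1, e2]
  rw [← integral_finsetSum _ fun k _ => (integrable_const _).indicator (hE k),
    ← integral_finsetSum _ fun t _ => (integrable_const _).indicator (hT t)]
  refine integral_congr_ae (ae_of_all _ fun s => ?_)
  have hle : (misdecoded act s.2.1 (unconstrainedDecision dec act s)).card ≤ Ka :=
    hact ▸ Finset.card_filter_le _ _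
  simp only [Set.indicator_apply, Set.mem_ofPred_eq, Finset.sum_ite_eq, Finset.mem_Icc]
  rw [Finset.sum_boole]
  change ((misdecoded act s.2.1 (unconstrainedDecision dec act s)).card : ℝ) = _
  split_ifs with h
  · rfl
  · have : (misdecoded act s.2.1 (unconstrainedDecision dec act s)).card = 0 := by omega
    rw [this, Nat.cast_zero]

/-- Replacing the constrained by the unconstrained codebooks costs at most `p₀`. -/
theorem pupe_le_pupeBound [NeZero n] [NeZero L] [NeZero M] [NeZero Ka] (P : ℝ) {v : ℝ}
    (hv : 0 < v) {act : Finset (Fin K)} (hact : act.card = Ka)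
    {dec : Codebook n K M → Received n L → Messages K M} (hdec : IsMLDecoder Ka dec)
    {S₁ : ℕ → Finset (Fin Ka)} (hS₁ : ∀ t ∈ Finset.Icc 1 Ka, (S₁ t).card = t) :
    pupe P v act dec ≤ pupeBound n K Ka M L P v S₁ := by
  have hKa : (0 : ℝ) < Ka := by exact_mod_cast Nat.pos_of_neZero Ka
  have hk : ∀ k, (sampleLaw n K M L v).real
        {s | dec s.1 (receivedSignal P act s) k ≠ some (s.2.1 k)}
      ≤ p0 n Ka P v + (sampleLaw n K M L v).real
        {s | unconstrainedDecision dec act s k ≠ some (s.2.1 k)} := fun k => by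
    refine (measureReal_mono (s₂ := powerViolation n K M L P act ∪
      {s | unconstrainedDecision dec act s k ≠ some (s.2.1 k)}) fun s hs => ?_).trans
      ((measureReal_union_le _ _).trans (add_le_add (sampleLaw_powerViolation_le P hv hact) le_rfl))
    by_cases hP : s ∈ powerViolation n K M L P act
    · exact Or.inl hP
    · rw [Set.mem_ofPred_eq, receivedSignal_of_notMem_powerViolation hP] at hs
      exact Or.inr hs
  have hsum : ∑ t ∈ Finset.Icc 1 Ka, (t : ℝ) * (sampleLaw n K M L v).real
        {s | (misdecoded act s.2.1 (unconstrainedDecision dec act s)).card = t}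
      ≤ ∑ t ∈ Finset.Icc 1 Ka, (t : ℝ) * min 1 (pt n K Ka M L t v (S₁ t)) :=
    Finset.sum_le_sum fun t ht => mul_le_mul_of_nonneg_left
      (sampleLaw_card_misdecoded_le hv hact hdec (Finset.mem_Icc.1 ht).1 (hS₁ t ht))
      (Nat.cast_nonneg t)
  rw [← sum_measureReal_misdecoded v hact hdec] at hsum
  have htotal := (Finset.sum_le_sum fun k (_ : k ∈ act) => hk k)
  rw [Finset.sum_add_distrib, Finset.sum_const, hact, nsmul_eq_mul] at htotal
  calc pupe P v act dec
      ≤ (1 / (Ka : ℝ)) * (Ka * p0 n Ka P v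
          + ∑ t ∈ Finset.Icc 1 Ka, (t : ℝ) * min 1 (pt n K Ka M L t v (S₁ t))) := by
        rw [pupe, hact]
        gcongr
        linarith
    _ = pupeBound n K Ka M L P v S₁ := by
        rw [pupeBound, mul_add, Finset.mul_sum]
        congr 1
        · field_simp
        · exact Finset.sum_congr rfl fun t _ => by ring

theorem sum_normSq_constrained_le {P : ℝ} (hP : 0 ≤ P) (c : Codebook n K M) (k : Fin K)
    (m : Fin M) : ∑ i, ‖constrained P c k m i‖ ^ 2 ≤ n * P := by
  unfold constrained
  split_ifs with h
  · exact h
  · simpa using by positivity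

end Experiment

end MassiveAccess

theorem mainTheorem6 (n K Ka M L : ℕ) (hn : 0 < n) (hM : 0 < M) (hL : 0 < L) (hKa : 0 < Ka)
    (act : Finset (Fin K)) (hact : act.card = Ka) (P : ℝ) (hP : 0 < P)
    (dec : MassiveAccess.Codebook n K M → MassiveAccess.Received n L → MassiveAccess.Messages K M)
    (hdec : MassiveAccess.IsMLDecoder Ka dec)
    (S₁ : ℕ → Finset (Fin Ka)) (hS₁ : ∀ t ∈ Finset.Icc 1 Ka, (S₁ t).card = t) :
    (∀ (c : MassiveAccess.Codebook n K M) (k : Fin K) (m : Fin M),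
      ∑ i, ‖MassiveAccess.constrained P c k m i‖ ^ 2 ≤ n * P) ∧
    (∀ P' ∈ Set.Ioo 0 P,
      MassiveAccess.pupe P P' act dec ≤ MassiveAccess.pupeBound n K Ka M L P P' S₁) ∧
    (⨅ P' : Set.Ioo 0 P, MassiveAccess.pupe P P' act dec) ≤
      ⨅ P' : Set.Ioo 0 P, MassiveAccess.pupeBound n K Ka M L P P' S₁ := by
  have : NeZero n := ⟨hn.ne'⟩
  have : NeZero L := ⟨hL.ne'⟩
  have : NeZero M := ⟨hM.ne'⟩
  have : NeZero Ka := ⟨hKa.ne'⟩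
  have hbound : ∀ P' ∈ Set.Ioo 0 P,
      MassiveAccess.pupe P P' act dec ≤ MassiveAccess.pupeBound n K Ka M L P P' S₁ :=
    fun P' hP' => MassiveAccess.pupe_le_pupeBound P hP'.1 hact hdec hS₁
  refine ⟨MassiveAccess.sum_normSq_constrained_le hP.le, hbound,
    ciInf_mono ⟨0, ?_⟩ fun P' => hbound P' P'.2⟩
  rintro _ ⟨P', rfl⟩
  exact mul_nonneg (by positivity) (Finset.sum_nonneg fun k _ => measureReal_nonneg)
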